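/- Let $S_0$ be a finite set and let $\{\boldsymbol Y_n\}=\{(X_{1,n},X_{2,n},J_n)\}$ be a two-dimensional skip-free Markov modulated random walk: a Markov chain on $\mathbb S=\mathbb Z^2\times S_0$ with transition matrix $P=(p_{\boldsymbol y,\boldsymbol y'})$ such that the increments of $X_{1,n}$ and $X_{2,n}$ lie in $\{-1,0,1\}$ and $p_{(x_1,x_2,j),(x_1+k,x_2+l,j')}$ does not depend on $(x_1,x_2)$. Put $A_{k,l}=(p_{(0,0,j),(k,l,j')})_{j,j'\in S_0}$ and $A_{*,*}(\theta_1,\theta_2)=\sum_{k,l\in\{-1,0,1\}}e^{k\theta_1+l\theta_2}A_{k,l}$. Let $\mathbb S_+=\mathbb Z_+^2\times S_0$, let $P_+$ be the restriction of $P$ to $\mathbb S_+$, let $\tau=\inf\{n\ge 0:\boldsymbol Y_n\notin\mathbb S_+\}$ and, for $\boldsymbol y,\boldsymbol y'\in\mathbb S_+$, let $\tilde q_{\boldsymbol y,\boldsymbol y'}=\mathbb E\big(\sum_{n=0}^{\tau-1}1(\boldsymbol Y_n=\boldsymbol y')\,\big|\,\boldsymbol Y_0=\boldsymbol y\big)$.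 Assume that $P$ is irreducible and aperiodic, that $P_+$ is irreducible, and that $a_1<0$ or $a_2<0$, where $a_1=\boldsymbol\pi\sum_{l}(-A_{-1,l}+A_{1,l})\mathbf 1$, $a_2=\boldsymbol\pi\sum_{k}(-A_{k,-1}+A_{k,1})\mathbf 1$ and $\boldsymbol\pi$ is the stationary distribution of $A_{*,*}(0,0)$. For a nonnegative matrix $M$ with finite or countable index set let $\mathrm{cp}(M)=\sup\{r\ge 0:\sum_{n\ge0}r^nM^n<\infty\}$ (entrywise). For $i\in\{-1,0,1\}$ let $A^{(1)}_i$ and $A^{(2)}_i$ be the block tri-diagonal matrices, indexed by $\mathbb Z_+\times S_0$, whose $(x,x')$-blocks are $A_{i,x'-x}$ and $A_{x'-x,i}$, respectively, if $|x'-x|\le1$, and $0$ otherwise. For $\alpha\in\{1,2\}$ let $R^{(\alpha)}$ be the minimal nonnegative solution of $R=R^2A^{(\alpha)}_{-1}+RA^{(\alpha)}_0+A^{(\alpha)}_1$. Let $\bar\Gamma$ be the closure of $\Gamma=\{\boldsymbol\theta\in\mathbb R^2:\mathrm{spr}(A_{*,*}(\boldsymbol\theta))<1\}$, where $\mathrm{spr}$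 is the spectral radius. For $\boldsymbol y\in\mathbb S_+$, $x_1',x_2'\in\mathbb Z_+$ and $j'\in S_0$ let $$r^{(1)}_{\boldsymbol y,(x_2',j')}=\sup\Big\{r\ge0:\sum_{k=0}^\infty\tilde q_{\boldsymbol y,(k,x_2',j')}r^k<\infty\Big\},\qquad r^{(2)}_{\boldsymbol y,(x_1',j')}=\sup\Big\{r\ge0:\sum_{k=0}^\infty\tilde q_{\boldsymbol y,(x_1',k,j')}r^k<\infty\Big\}.$$ Then the minimal solutions $R^{(1)},R^{(2)}$ and the maxima $\bar\theta^{(1)}_1=\max\{\theta_1:\boldsymbol\theta\in\bar\Gamma\}$ and $\bar\theta^{(2)}_2=\max\{\theta_2:\boldsymbol\theta\in\bar\Gamma\}$ exist, and for every $\boldsymbol y\in\mathbb S_+$, $x_1',x_2'\in\mathbb Z_+$ and $j'\in S_0$, $$r^{(1)}_{\boldsymbol y,(x_2',j')}=\mathrm{cp}(R^{(1)})=e^{\bar\theta^{(1)}_1},\qquad r^{(2)}_{\boldsymbol y,(x_1',j')}=\mathrm{cp}(R^{(2)})=e^{\bar\theta^{(2)}_2}.$$ Moreover, for every $\boldsymbol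 x\in\mathbb Z_+^2$, with $N_{\boldsymbol x,\boldsymbol x'}=(\tilde q_{(\boldsymbol x,j),(\boldsymbol x',j')})_{j,j'\in S_0}$, the matrix power series $\hat\Phi^{(1)}_{\boldsymbol x}(z)=\sum_{k\ge1}z^kN_{\boldsymbol x,(k,0)}$ and $\hat\Phi^{(2)}_{\boldsymbol x}(z)=\sum_{k\ge1}z^kN_{\boldsymbol x,(0,k)}$ have radii of convergence $e^{\bar\theta^{(1)}_1}$ and $e^{\bar\theta^{(2)}_2}$, respectively, where the radius of convergence is the supremum of the $r\ge0$ at which all entries converge. -/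

import Mathlib

open scoped ENNReal NNReal

noncomputable section

/-! ### Nonnegative matrices over a (finite or countable) index set -/

/-- A nonnegative matrix indexed by an arbitrary type, with entries in `[0, ∞]`. -/
abbrev NNMat (ι : Type*) := ι → ι → ℝ≥0∞

namespace NNMat

variable {ι : Type*}

open Classical in
/-- The identity matrix. -/
def id : NNMat ι := fun i j => if i = j then 1 else 0

/-- The matrix product `[M N]_{i,j} = ∑_k M_{i,k} N_{k,j}`. -/
def mul (M N : NNMat ι) : NNMat ι := fun i j => ∑' k, M i k * N k j

/-- The powers `M ^ n` of a matrix. -/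
def pow (M : NNMat ι) : ℕ → NNMat ι
  | 0 => id
  | n + 1 => mul (pow M n) M

/-- Irreducibility: every state leads to every state in a positive number of steps. -/
def Irreducible (M : NNMat ι) : Prop :=
  ∀ i j, ∃ n > 0, 0 < pow M n i j

/-- Aperiodicity: for every state, the greatest common divisor of the possible return times
is `1`. -/
def Aperiodic (M : NNMat ι) : Prop :=
  ∀ i, ∀ d : ℕ, (∀ n > 0, 0 < pow M n i i → d ∣ n) → d = 1

/-- The convergence parameter `cp(M) = sup {r ≥ 0 : ∑_n r ^ n M ^ n < ∞}`, where finiteness is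
understood entrywise. -/
def cp (M : NNMat ι) : ℝ≥0∞ :=
  ⨆ (r : ℝ≥0) (_ : ∀ i j, ∑' n : ℕ, (r : ℝ≥0∞) ^ n * pow M n i j < ∞), (r : ℝ≥0∞)

/-- `R` is the rate matrix generated from the triplet `{B₋₁, B₀, B₁}`: the minimal nonnegative
(finite-valued) solution of `R = R² B₋₁ + R B₀ + B₁`. -/
def IsRateMatrix (Bneg Bzero Bpos R : NNMat ι) : Prop :=
  IsLeast {X : NNMat ι | (∀ i j, X i j < ∞) ∧
    X = mul (mul X X) Bneg + mul X Bzero + Bpos} R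

end NNMat

/-- The state space `ℤ² × S₀`. -/
abbrev MMRWState (S₀ : Type*) := ℤ × ℤ × S₀

/-- The index set `ℤ₊² × S₀`. -/
abbrev MMRWQuad (S₀ : Type*) := ℕ × ℕ × S₀

/-- The transition probabilities of a two-dimensional skip-free Markov modulated random walk:
`step y y'` is the probability of moving from `y` to `y'` in one step. -/
structure MMRW (S₀ : Type*) where
  step : MMRWState S₀ → PMF (MMRWState S₀)
  skipFree : ∀ x₁ x₂ j x₁' x₂' j', step (x₁, x₂, j) (x₁', x₂', j') ≠ 0 →
    x₁' - x₁ ∈ ({-1, 0, 1} : Set ℤ) ∧ x₂' - x₂ ∈ ({-1, 0, 1} : Set ℤ)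
  homogeneous : ∀ (x₁ x₂ x₁' x₂' k l : ℤ) (j j' : S₀),
    step (x₁, x₂, j) (x₁ + k, x₂ + l, j') = step (x₁', x₂', j) (x₁' + k, x₂' + l, j')

namespace MMRW

variable {S₀ : Type*}

/-- The inclusion of `ℤ₊² × S₀` in `ℤ² × S₀`. -/
def emb (y : MMRWQuad S₀) : MMRWState S₀ := ((y.1 : ℤ), (y.2.1 : ℤ), y.2.2)

/-- The nonnegative area `𝕊₊ = ℤ₊² × S₀` as a subset of `𝕊 = ℤ² × S₀`. -/
def quadrant (S₀ : Type*) : Set (MMRWState S₀) := {y | 0 ≤ y.1 ∧ 0 ≤ y.2.1}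

variable (W : MMRW S₀)

/-- The transition probability matrix `P` on `ℤ² × S₀`. -/
def P : NNMat (MMRWState S₀) := fun y y' => W.step y y'

/-- The truncation `P₊` of `P` to `ℤ₊² × S₀`. -/
def Pplus : NNMat (MMRWQuad S₀) := fun y y' => W.P (emb y) (emb y')

/-- The block `A_{k,l} = (p_{(0,0,j),(k,l,j')})_{j,j'}`, which vanishes
unless `k, l ∈ {-1, 0, 1}`. -/
def A (k l : ℤ) : NNMat S₀ := fun j j' => W.P (0, 0, j) (k, l, j')

/-- The block `A_{k,l}` as a real matrix. -/
def Areal (k l : ℤ) : Matrix S₀ S₀ ℝ := Matrix.of fun j j' => (W.A k l j j').toReal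

/-- `A_{*,*}(θ₁, θ₂) = ∑_{k,l ∈ {-1,0,1}} e^{k θ₁ + l θ₂} A_{k,l}`. -/
def Amgf (θ : ℝ × ℝ) : Matrix S₀ S₀ ℝ :=
  ∑ k ∈ ({-1, 0, 1} : Finset ℤ), ∑ l ∈ ({-1, 0, 1} : Finset ℤ),
    Real.exp (k * θ.1 + l * θ.2) • W.Areal k l

/-- `Γ = {θ ∈ ℝ² : spr(A_{*,*}(θ)) < 1}`, where the spectral radius is the maximum modulus
of the complex eigenvalues. -/
def Gam [Fintype S₀] [DecidableEq S₀] : Set (ℝ × ℝ) :=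
  {θ | spectralRadius ℂ ((W.Amgf θ).map (algebraMap ℝ ℂ)) < 1}

/-- `π` is a stationary distribution of `A_{*,*} = A_{*,*}(0, 0)`. -/
def IsStationary [Fintype S₀] (π : S₀ → ℝ) : Prop :=
  (∀ j, 0 ≤ π j) ∧ ∑ j, π j = 1 ∧ Matrix.vecMul π (W.Amgf (0, 0)) = π

/-- `a₁ = π (-A_{-1,*} + A_{1,*}) 𝟏`. -/
def drift₁ [Fintype S₀] (π : S₀ → ℝ) : ℝ :=
  π ⬝ᵥ Matrix.mulVec
    (-(∑ l ∈ ({-1, 0, 1} : Finset ℤ), W.Areal (-1) l)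
      + ∑ l ∈ ({-1, 0, 1} : Finset ℤ), W.Areal 1 l) 1

/-- `a₂ = π (-A_{*,-1} + A_{*,1}) 𝟏`. -/
def drift₂ [Fintype S₀] (π : S₀ → ℝ) : ℝ :=
  π ⬝ᵥ Matrix.mulVec
    (-(∑ k ∈ ({-1, 0, 1} : Finset ℤ), W.Areal k (-1))
      + ∑ k ∈ ({-1, 0, 1} : Finset ℤ), W.Areal k 1) 1

/-- The block tri-diagonal matrix `A^{(1)}_i`, with phase `(x₂, j)`: its `(x₂, x₂')`-block is
`A_{i, x₂' - x₂}`. -/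
def A1 (i : ℤ) : NNMat (ℕ × S₀) :=
  fun u v => W.A i ((v.1 : ℤ) - (u.1 : ℤ)) u.2 v.2

/-- The block tri-diagonal matrix `A^{(2)}_i`, with phase `(x₁, j)`: its `(x₁, x₁')`-block is
`A_{x₁' - x₁, i}`. -/
def A2 (i : ℤ) : NNMat (ℕ × S₀) :=
  fun u v => W.A ((v.1 : ℤ) - (u.1 : ℤ)) i u.2 v.2

/-- Under the probability measure `ℙ`, the process `Y` is a Markov chain with the transition
probabilities of `W`, starting from `y`. -/
structure IsChain {Ω : Type*} [MeasurableSpace Ω] (ℙ : MeasureTheory.Measure Ω)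
    (Y : ℕ → Ω → MMRWState S₀) (y : MMRWState S₀) : Prop where
  isProbability : MeasureTheory.IsProbabilityMeasure ℙ
  measurable : ∀ n z, MeasurableSet {ω | Y n ω = z}
  start : ℙ {ω | Y 0 ω = y} = 1
  markov : ∀ (n : ℕ) (z : ℕ → MMRWState S₀),
    ℙ {ω | ∀ i ≤ n + 1, Y i ω = z i} = ℙ {ω | ∀ i ≤ n, Y i ω = z i} * W.P (z n) (z (n + 1))

section Occupation

variable {Ω : Type*}

/-- The time `τ` at which the process enters `𝕊 ∖ 𝕊₊` for the first time (`⊤` if it never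
does). -/
def exitTime (Y : ℕ → Ω → MMRWState S₀) : Ω → WithTop ℕ :=
  MeasureTheory.hittingAfter Y (quadrant S₀)ᶜ 0

variable [MeasurableSpace Ω] (ℙ : MMRWState S₀ → MeasureTheory.Measure Ω)
  (Y : ℕ → Ω → MMRWState S₀)

/-- The occupation measure `q̃_{y,y'} = 𝔼_y [∑_{n < τ} 1(Y_n = y')]`, where `ℙ y` is the law under
which the process starts from `y`. -/
def occ (y y' : MMRWQuad S₀) : ℝ≥0∞ :=
  ∫⁻ ω, ∑' n : ℕ, Set.indicator {n : ℕ | (n : WithTop ℕ) < exitTime Y ω ∧ Y n ω = emb y'}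
    (fun _ => (1 : ℝ≥0∞)) n ∂(ℙ (emb y))

/-- The generating function `φ̂^{(1)}_{y,(x₂',j')}(r) = ∑_{k ≥ 0} q̃_{y,(k,x₂',j')} r ^ k`. -/
def gen₁ (y : MMRWQuad S₀) (x₂' : ℕ) (j' : S₀) (r : ℝ≥0) : ℝ≥0∞ :=
  ∑' k : ℕ, occ ℙ Y y (k, x₂', j') * (r : ℝ≥0∞) ^ k

/-- The generating function `φ̂^{(2)}_{y,(x₁',j')}(r) = ∑_{k ≥ 0} q̃_{y,(x₁',k,j')} r ^ k`. -/
def gen₂ (y : MMRWQuad S₀) (x₁' : ℕ) (j' : S₀) (r : ℝ≥0) : ℝ≥0∞ :=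
  ∑' k : ℕ, occ ℙ Y y (x₁', k, j') * (r : ℝ≥0∞) ^ k

/-- The radius of convergence `r^{(1)}_{y,(x₂',j')}` of `φ̂^{(1)}_{y,(x₂',j')}`. -/
def rad₁ (y : MMRWQuad S₀) (x₂' : ℕ) (j' : S₀) : ℝ≥0∞ :=
  ⨆ (r : ℝ≥0) (_ : gen₁ ℙ Y y x₂' j' r < ∞), (r : ℝ≥0∞)

/-- The radius of convergence `r^{(2)}_{y,(x₁',j')}` of `φ̂^{(2)}_{y,(x₁',j')}`. -/
def rad₂ (y : MMRWQuad S₀) (x₁' : ℕ) (j' : S₀) : ℝ≥0∞ :=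
  ⨆ (r : ℝ≥0) (_ : gen₂ ℙ Y y x₁' j' r < ∞), (r : ℝ≥0∞)

/-- The block `N_{x,x'} = (q̃_{(x,j),(x',j')})_{j,j'}`. -/
def N (x x' : ℕ × ℕ) : NNMat S₀ := fun j j' => occ ℙ Y (x.1, x.2, j) (x'.1, x'.2, j')

/-- The matrix generating function `Φ̂^{(1)}_x(r) = ∑_{k ≥ 1} r ^ k N_{x,(k,0)}`. -/
def Phi₁ (x : ℕ × ℕ) (r : ℝ≥0) : NNMat S₀ := fun j j' =>
  ∑' k : ℕ, (r : ℝ≥0∞) ^ (k + 1) * N ℙ Y x (k + 1, 0) j j'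

/-- The matrix generating function `Φ̂^{(2)}_x(r) = ∑_{k ≥ 1} r ^ k N_{x,(0,k)}`. -/
def Phi₂ (x : ℕ × ℕ) (r : ℝ≥0) : NNMat S₀ := fun j j' =>
  ∑' k : ℕ, (r : ℝ≥0∞) ^ (k + 1) * N ℙ Y x (0, k + 1) j j'

/-- The radius of convergence of `Φ̂^{(1)}_x` (all entries converge). -/
def radPhi₁ (x : ℕ × ℕ) : ℝ≥0∞ :=
  ⨆ (r : ℝ≥0) (_ : ∀ j j', Phi₁ ℙ Y x r j j' < ∞), (r : ℝ≥0∞)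

/-- The radius of convergence of `Φ̂^{(2)}_x` (all entries converge). -/
def radPhi₂ (x : ℕ × ℕ) : ℝ≥0∞ :=
  ⨆ (r : ℝ≥0) (_ : ∀ j j', Phi₂ ℙ Y x r j j' < ∞), (r : ℝ≥0∞)

end Occupation

end MMRW

end

/-! The occupation measure is the Green function `∑ₙ P₊ⁿ`, so every claim concerns excessive
measures of `P₊`: nonnegative `q` with `q P₊ ≤ q`. The measures e^{-⟨θ, x⟩} v_j with `v > 0` are of
this kind as soon as `v A(θ) ≤ v`, where `A(θ)` is the matrix `Amgf`, and the proof compares all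
others with them.

Lower bounds on the radii: for `θ ∈ Γ` there is `v > 0` with `v A(θ) ≤ ρ v`, `ρ < 1`. Iteration
bounds the Green function by a multiple of e^{-⟨θ, x⟩} (`exists_green_le`). Reading the same
inequality on successive levels of one coordinate shows that a slice `x` of the weight satisfies `x
R ≤ e^{-θ_α} x`, hence `cp R ≥ e^{θ_α}` (`vmul_rate_le`, `le_cp`). Continuity extends both to the
closure of `Γ`.

Upper bounds: let `q` be a positive finite excessive measure whose generating function along a
coordinate line converges at `r`. Irreducibility and translation give a Harnack inequality, so `log
q` has bounded increments. Their average under a translation-invariant mean on `ℕ²` is affine in the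
displacement, and Jensen's inequality preserves excessiveness; the result is an exponential
excessive measure with `log r ≤ θ_α` (`exists_exponential_excessive`). Then `v A(θ) ≤ v`, and
convexity together with one point of `Γ` puts `θ` in the closure of `Γ` (`mem_closure_Gam`). This
applies to the Green function, and to the rate matrix as well, since the rows of `R^{k+1}`, stacked
over the levels `k`, form an excessive measure (`excessive_pow_rate₁`).

`Γ` is nonempty because a negative drift allows a first-order perturbation of the stochastic matrix
`A(0)` with spectral radius below one (`Gam_nonempty_of_direction`), and bounded because `P` is
irreducible (`exists_bound_Gam`), so the maxima exist. -/

open Filter Topology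

/-! ### Banach limits of bounded sequences -/

/-- The Cesàro means of a sequence. -/
noncomputable def cesaro (f : ℕ → ℝ) (n : ℕ) : ℝ := (∑ i ∈ Finset.range n, f i) / n

/-- A Banach limit: the limit of the Cesàro means along a nonprincipal ultrafilter. -/
noncomputable def banachLim (f : ℕ → ℝ) : ℝ := limUnder (hyperfilter ℕ : Filter ℕ) (cesaro f)

/-- Boundedness of a real-valued function. -/
def IsBdd {ι : Type*} (f : ι → ℝ) : Prop := ∃ C, ∀ n, |f n| ≤ C

theorem abs_cesaro_le {f : ℕ → ℝ} {C : ℝ} (h : ∀ n, |f n| ≤ C) (n : ℕ) : |cesaro f n| ≤ C := by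
  have hC : 0 ≤ C := (abs_nonneg _).trans (h 0)
  unfold cesaro
  rw [abs_div, Nat.abs_cast]
  rcases Nat.eq_zero_or_pos n with rfl | hn
  · simpa using hC
  · rw [div_le_iff₀ (by exact_mod_cast hn)]
    calc |∑ i ∈ Finset.range n, f i| ≤ ∑ i ∈ Finset.range n, |f i| := Finset.abs_sum_le_sum_abs _ _
      _ ≤ ∑ i ∈ Finset.range n, C := Finset.sum_le_sum fun i _ => h i
      _ = C * n := by simp [mul_comm]

/-- An ultrafilter on a compact interval converges, so `limUnder` returns a genuine limit here. -/
theorem IsBdd.tendsto_banachLim {f : ℕ → ℝ} (h : IsBdd f) :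
    Tendsto (cesaro f) (hyperfilter ℕ) (𝓝 (banachLim f)) := by
  obtain ⟨C, hC⟩ := h
  have hc : IsCompact (Set.Icc (-C) C) := isCompact_Icc
  obtain ⟨x, -, hx⟩ := hc.ultrafilter_le_nhds ((hyperfilter ℕ).map (cesaro f)) (by
    rw [le_principal_iff]
    exact mem_map.2 (Eventually.of_forall fun n => abs_le.1 (abs_cesaro_le hC n)))
  exact tendsto_nhds_limUnder ⟨x, hx⟩

theorem tendsto_hyperfilter {f : ℕ → ℝ} {l : Filter ℝ} (h : Tendsto f atTop l) :
    Tendsto f (hyperfilter ℕ) l :=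
  h.mono_left (by simpa using Nat.hyperfilter_le_atTop)

theorem abs_banachLim_le {f : ℕ → ℝ} {C : ℝ} (h : ∀ n, |f n| ≤ C) : |banachLim f| ≤ C :=
  le_of_tendsto (IsBdd.tendsto_banachLim ⟨C, h⟩).abs (Eventually.of_forall (abs_cesaro_le h))

theorem banachLim_add {f g : ℕ → ℝ} (hf : IsBdd f) (hg : IsBdd g) :
    banachLim (fun n => f n + g n) = banachLim f + banachLim g := by
  refine ((hf.tendsto_banachLim.add hg.tendsto_banachLim).congr fun n => ?_).limUnder_eq
  simp [cesaro, Finset.sum_add_distrib, add_div]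

theorem banachLim_const_mul {f : ℕ → ℝ} (hf : IsBdd f) (c : ℝ) :
    banachLim (fun n => c * f n) = c * banachLim f := by
  refine ((hf.tendsto_banachLim.const_mul c).congr fun n => ?_).limUnder_eq
  simp [cesaro, ← Finset.mul_sum, mul_div_assoc]

theorem banachLim_mono {f g : ℕ → ℝ} (hf : IsBdd f) (hg : IsBdd g) (h : ∀ n, f n ≤ g n) :
    banachLim f ≤ banachLim g := by
  refine le_of_tendsto_of_tendsto' hf.tendsto_banachLim hg.tendsto_banachLim fun n => ?_
  unfold cesaro
  gcongr
  exact h _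

theorem banachLim_const (c : ℝ) : banachLim (fun _ => c) = c := by
  refine Tendsto.limUnder_eq (tendsto_hyperfilter ?_)
  refine tendsto_const_nhds.congr' ?_
  -- At `n = 0` the Cesàro mean is `0 / 0 = 0`, so the identity holds only eventually.
  filter_upwards [eventually_gt_atTop 0] with n hn
  have : (n : ℝ) ≠ 0 := by positivity
  simp [cesaro]; field_simp

/-- The Cesàro means of increments telescope to `(g n - g 0) / n`, so a linear upper bound on `g`
controls the mean increment. -/
theorem banachLim_sub_le {g : ℕ → ℝ} (hb : IsBdd fun n => g (n + 1) - g n) {M t : ℝ}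
    (h : ∀ n, g n ≤ M - n * t) : banachLim (fun n => g (n + 1) - g n) ≤ -t := by
  have h1 : Tendsto (fun n : ℕ => (M - g 0) / n - t) (hyperfilter ℕ) (𝓝 (0 - t)) :=
    tendsto_hyperfilter ((tendsto_const_div_atTop_nhds_zero_nat _).sub_const t)
  rw [zero_sub] at h1
  refine le_of_tendsto_of_tendsto hb.tendsto_banachLim h1 ?_
  have h2 : ∀ᶠ n : ℕ in (hyperfilter ℕ : Filter ℕ), 0 < n :=
    Nat.hyperfilter_le_atTop (eventually_gt_atTop 0)
  filter_upwards [h2] with n hn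
  have hn' : (0 : ℝ) < n := by exact_mod_cast hn
  rw [cesaro, Finset.sum_range_sub, div_sub' hn'.ne']
  exact div_le_div_of_nonneg_right (by linarith [h n]) hn'.le

/-- A bounded sequence grows at rate zero, so `banachLim_sub_le` with `t = 0`, used for `f` and for
`-f`, makes the mean increment vanish. -/
theorem banachLim_shift {f : ℕ → ℝ} (hf : IsBdd f) :
    banachLim (fun n => f (n + 1)) = banachLim f := by
  obtain ⟨C, hC⟩ := hf
  have h1 : IsBdd (fun n => f (n + 1)) := ⟨C, fun n => hC _⟩
  have h2 : IsBdd (fun n => f (n + 1) - f n) :=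
    ⟨C + C, fun n => (abs_sub _ _).trans (add_le_add (hC _) (hC _))⟩
  have h3 : IsBdd (fun n => f n - f (n + 1)) :=
    ⟨C + C, fun n => (abs_sub _ _).trans (add_le_add (hC _) (hC _))⟩
  have e1 : banachLim (fun n => f (n + 1) - f n) ≤ -0 :=
    banachLim_sub_le (g := f) (t := 0) h2 (M := C) fun n => by simpa using (abs_le.1 (hC n)).2
  have e5 : (fun n => -f (n + 1) - -f n) = fun n => f n - f (n + 1) := by funext n; ring
  have e2 : banachLim (fun n => f n - f (n + 1)) ≤ -0 := by
    rw [← e5] at h3 ⊢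
    refine banachLim_sub_le (g := fun n => -f n) (t := 0) h3 (M := C) fun n => ?_
    have := (abs_le.1 (hC n)).1
    simp only [mul_zero, sub_zero]; linarith
  have e3 := banachLim_add h2 (g := f) ⟨C, hC⟩
  have e4 := banachLim_add h3 h1
  simp only [sub_add_cancel] at e3 e4
  linarith

/-! ### A translation-invariant mean on `ℕ²` and Jensen's inequality -/

/-- Boundedness of a real-valued function of two variables. -/
def IsBdd₂ (f : ℕ → ℕ → ℝ) : Prop := ∃ C, ∀ x y, |f x y| ≤ C

/-- An invariant mean for bounded functions on `ℕ²`. -/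
noncomputable def mean₂ (f : ℕ → ℕ → ℝ) : ℝ := banachLim fun y => banachLim fun x => f x y

namespace IsBdd₂

variable {f g : ℕ → ℕ → ℝ}

theorem fst (hf : IsBdd₂ f) (y : ℕ) : IsBdd fun x => f x y := hf.imp fun _ h x => h x y

theorem snd (hf : IsBdd₂ f) : IsBdd fun y => banachLim fun x => f x y :=
  hf.imp fun _ h y => abs_banachLim_le fun x => h x y

theorem add (hf : IsBdd₂ f) (hg : IsBdd₂ g) : IsBdd₂ fun x y => f x y + g x y := by
  obtain ⟨C, hC⟩ := hf
  obtain ⟨D, hD⟩ := hg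
  exact ⟨C + D, fun x y => (abs_add_le _ _).trans (add_le_add (hC _ _) (hD _ _))⟩

theorem const_mul (hf : IsBdd₂ f) (c : ℝ) : IsBdd₂ fun x y => c * f x y := by
  obtain ⟨C, hC⟩ := hf
  exact ⟨|c| * C, fun x y => by rw [abs_mul]; gcongr; exact hC _ _⟩

theorem const (c : ℝ) : IsBdd₂ fun _ _ => c := ⟨|c|, fun _ _ => le_rfl⟩

theorem exp (hf : IsBdd₂ f) : IsBdd₂ fun x y => Real.exp (f x y) := by
  obtain ⟨C, hC⟩ := hf
  exact ⟨Real.exp C, fun x y => by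
    rw [abs_of_pos (Real.exp_pos _)]; exact Real.exp_le_exp.2 (abs_le.1 (hC x y)).2⟩

theorem sum {ι : Type*} (s : Finset ι) {f : ι → ℕ → ℕ → ℝ} (hf : ∀ i, IsBdd₂ (f i)) :
    IsBdd₂ fun x y => ∑ i ∈ s, f i x y := by
  classical
  induction s using Finset.induction_on with
  | empty => simpa using const 0
  | insert a s ha ih => simpa [Finset.sum_insert ha] using (hf a).add ih

end IsBdd₂

section Mean

variable {f g : ℕ → ℕ → ℝ}

theorem mean₂_add (hf : IsBdd₂ f) (hg : IsBdd₂ g) :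
    mean₂ (fun x y => f x y + g x y) = mean₂ f + mean₂ g := by
  simp only [mean₂, banachLim_add (hf.fst _) (hg.fst _)]
  exact banachLim_add (f := fun y => banachLim fun x => f x y)
    (g := fun y => banachLim fun x => g x y) hf.snd hg.snd

theorem mean₂_const_mul (hf : IsBdd₂ f) (c : ℝ) :
    mean₂ (fun x y => c * f x y) = c * mean₂ f := by
  simp only [mean₂, banachLim_const_mul (hf.fst _)]
  exact banachLim_const_mul (f := fun y => banachLim fun x => f x y) hf.snd c

theorem mean₂_const (c : ℝ) : mean₂ (fun _ _ => c) = c := by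
  simp only [mean₂, banachLim_const]

theorem mean₂_mono (hf : IsBdd₂ f) (hg : IsBdd₂ g) (h : ∀ x y, f x y ≤ g x y) :
    mean₂ f ≤ mean₂ g :=
  banachLim_mono hf.snd hg.snd fun y => banachLim_mono (hf.fst y) (hg.fst y) fun x => h x y

theorem mean₂_shift_fst (hf : IsBdd₂ f) : mean₂ (fun x y => f (x + 1) y) = mean₂ f := by
  unfold mean₂
  congr 1
  funext y
  exact banachLim_shift (f := fun x => f x y) (hf.fst y)

theorem mean₂_shift_snd (hf : IsBdd₂ f) : mean₂ (fun x y => f x (y + 1)) = mean₂ f :=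
  banachLim_shift (f := fun y => banachLim fun x => f x y) hf.snd

theorem mean₂_sum {ι : Type*} (s : Finset ι) {f : ι → ℕ → ℕ → ℝ} (hf : ∀ i, IsBdd₂ (f i)) :
    mean₂ (fun x y => ∑ i ∈ s, f i x y) = ∑ i ∈ s, mean₂ (f i) := by
  classical
  induction s using Finset.induction_on with
  | empty => simpa using mean₂_const 0
  | insert a s ha ih =>
    simp only [Finset.sum_insert ha]
    rw [mean₂_add (hf a) (IsBdd₂.sum s hf), ih]

/-- Jensen's inequality for the exponential function and an invariant mean. -/
theorem exp_mean₂_le (hf : IsBdd₂ f) :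
    Real.exp (mean₂ f) ≤ mean₂ fun x y => Real.exp (f x y) := by
  set c := mean₂ f
  have hb : IsBdd₂ fun x y => Real.exp c * (f x y + (1 - c)) :=
    (hf.add (IsBdd₂.const _)).const_mul _
  have h := mean₂_mono hb hf.exp fun x y => by
    -- The tangent to `exp` at `c = mean₂ f` lies below the graph, and its mean is exactly `exp c`.
    have h1 := Real.add_one_le_exp (f x y - c)
    calc Real.exp c * (f x y + (1 - c)) ≤ Real.exp c * Real.exp (f x y - c) := by
          gcongr; linarith
      _ = Real.exp (f x y) := by rw [← Real.exp_add]; congr 1; ring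
  rw [mean₂_const_mul (hf.add (IsBdd₂.const _)), mean₂_add hf (IsBdd₂.const _),
    mean₂_const] at h
  change Real.exp c * (c + (1 - c)) ≤ _ at h
  simpa using h

end Mean

/-! ### From an excessive measure to an exponential one -/

section LogExcessive

variable {S : Type*} [Fintype S]

/-- Averaging the increments of the logarithm of an excessive measure on the quadrant yields an
exponential excessive measure. -/
theorem exists_exponential_excessive (a : ℤ → ℤ → S → S → ℝ) (ha : ∀ m n i j, 0 ≤ a m n i j)
    (g : ℕ → ℕ → S → ℝ)
    (hg : ∀ s t s' t' i j, IsBdd₂ fun x y => g (x + s) (y + t) i - g (x + s') (y + t') j)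
    (hexc : ∀ x y j, ∑ s : Fin 3, ∑ t : Fin 3, ∑ i, a (1 - (s : ℕ)) (1 - (t : ℕ)) i j *
      Real.exp (g (x + s) (y + t) i - g (x + 1) (y + 1) j) ≤ 1)
    (l₀ : ℕ) (j₀ : S) (τ M : ℝ) (hdec : ∀ k : ℕ, g k l₀ j₀ ≤ M - k * τ) :
    ∃ (θ : ℝ × ℝ) (v : S → ℝ), τ ≤ θ.1 ∧ (∀ i, 0 < v i) ∧
      ∀ j, ∑ s : Fin 3, ∑ t : Fin 3, ∑ i, v i *
        (Real.exp ((1 - (s : ℕ)) * θ.1 + (1 - (t : ℕ)) * θ.2) * a (1 - (s : ℕ)) (1 - (t : ℕ)) i j)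
          ≤ v j := by
  -- Mean log-ratio between a displaced state and the reference phase `j₀` at the base point.
  -- Invariance of the mean makes `D` affine in `(s, t)`: its slopes become `-θ`, its phase part
  -- becomes `log v`.
  let D : ℕ → ℕ → S → ℝ := fun s t i => mean₂ fun x y => g (x + s) (y + t) i - g x y j₀
  have hg0 : ∀ s t i, IsBdd₂ fun x y => g (x + s) (y + t) i - g x y j₀ := fun s t i => by
    simpa using hg s t 0 0 i j₀
  have hD1 : ∀ s t i, D (s + 1) t i = D s t i + D 1 0 j₀ := fun s t i => by
    have h1 := mean₂_shift_fst (hg0 s t i)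
    have h2 := mean₂_add (f := fun x y => g (x + 1 + s) (y + t) i - g (x + 1) y j₀)
      (by simpa [add_assoc] using hg (1 + s) t 1 0 i j₀) (hg0 1 0 j₀)
    simp only [add_zero] at h2
    simp only [D, add_zero]
    rw [← h1, ← h2]
    congr 1
    funext x y
    rw [show x + (s + 1) = x + 1 + s by ring]
    ring
  have hD2 : ∀ s t i, D s (t + 1) i = D s t i + D 0 1 j₀ := fun s t i => by
    have h1 := mean₂_shift_snd (hg0 s t i)
    have h2 := mean₂_add (f := fun x y => g (x + s) (y + 1 + t) i - g x (y + 1) j₀)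
      (by simpa [add_assoc] using hg s (1 + t) 0 1 i j₀) (hg0 0 1 j₀)
    simp only [add_zero] at h2
    simp only [D, add_zero]
    rw [← h1, ← h2]
    congr 1
    funext x y
    rw [show y + (t + 1) = y + 1 + t by ring]
    ring
  have hD1' : ∀ s t i, D s t i = D 0 t i + s * D 1 0 j₀ := fun s t i => by
    induction s with
    | zero => simp
    | succ s ih => rw [hD1, ih]; push_cast; ring
  have hD2' : ∀ t i, D 0 t i = D 0 0 i + t * D 0 1 j₀ := fun t i => by
    induction t with
    | zero => simp
    | succ s ih => rw [hD2, ih]; push_cast; ring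
  have hF : ∀ s t i j, mean₂ (fun x y => g (x + s) (y + t) i - g (x + 1) (y + 1) j)
      = (s - 1) * D 1 0 j₀ + (t - 1) * D 0 1 j₀ + (D 0 0 i - D 0 0 j) := fun s t i j => by
    have h2 := mean₂_add (hg s t 1 1 i j) (hg0 1 1 j)
    simp only [sub_add_sub_cancel] at h2
    change D s t i = _ + D 1 1 j at h2
    have e1 := hD1' s t i
    have e2 := hD1' 1 1 j
    have e3 := hD2' t i
    have e4 := hD2' 1 j
    push_cast at e2 e4
    linarith
  refine ⟨(-D 1 0 j₀, -D 0 1 j₀), fun i => Real.exp (D 0 0 i), ?_, fun i => Real.exp_pos _, ?_⟩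
  -- The decay is assumed on the line `l₀` only. Other lines differ from it by a constant depending
  -- on `y`, which does not affect the mean slope.
  · have hx : ∀ y, (banachLim fun x => g (x + 1) y j₀ - g x y j₀) ≤ -τ := fun y => by
      obtain ⟨C, hC⟩ := hg 0 y 0 l₀ j₀ j₀
      refine banachLim_sub_le (g := fun x => g x y j₀) ((hg0 1 0 j₀).fst y) (M := M + C) fun n => ?_
      have h1 := (abs_le.1 (hC n 0)).2
      simp only [add_zero, zero_add] at h1
      linarith [hdec n]
    have h2 := banachLim_mono (hg0 1 0 j₀).snd (g := fun _ => -τ) ⟨|-τ|, fun _ => le_rfl⟩ hx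
    rw [banachLim_const] at h2
    change D 1 0 j₀ ≤ -τ at h2
    change τ ≤ -D 1 0 j₀
    linarith
  · intro j
    have hb : ∀ (s t : Fin 3) (i : S), IsBdd₂ fun x y => a (1 - (s : ℕ)) (1 - (t : ℕ)) i j *
        Real.exp (g (x + s) (y + t) i - g (x + 1) (y + 1) j) := fun s t i =>
      (hg s t 1 1 i j).exp.const_mul _
    have hb2 : ∀ (s t : Fin 3), IsBdd₂ fun x y => ∑ i, a (1 - (s : ℕ)) (1 - (t : ℕ)) i j *
        Real.exp (g (x + s) (y + t) i - g (x + 1) (y + 1) j) := fun s t => IsBdd₂.sum _ (hb s t)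
    have hb1 : ∀ (s : Fin 3), IsBdd₂ fun x y => ∑ t : Fin 3, ∑ i,
        a (1 - (s : ℕ)) (1 - (t : ℕ)) i j *
        Real.exp (g (x + s) (y + t) i - g (x + 1) (y + 1) j) := fun s => IsBdd₂.sum _ (hb2 s)
    have h1 := mean₂_mono (IsBdd₂.sum Finset.univ hb1) (IsBdd₂.const 1) fun x y => hexc x y j
    rw [mean₂_const, mean₂_sum _ hb1] at h1
    simp only [mean₂_sum _ (hb2 _), mean₂_sum _ (hb _ _),
      mean₂_const_mul (hg _ _ 1 1 _ j).exp] at h1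
    -- Jensen's inequality is applied term by term, which is possible because the coefficients `a`
    -- are nonnegative.
    have h3 : ∑ s : Fin 3, ∑ t : Fin 3, ∑ i, a (1 - (s : ℕ)) (1 - (t : ℕ)) i j *
        Real.exp (((s : ℕ) - 1) * D 1 0 j₀ + ((t : ℕ) - 1) * D 0 1 j₀ + (D 0 0 i - D 0 0 j))
        ≤ 1 := by
      refine le_trans ?_ h1
      gcongr with s _ t _ i _
      · exact ha _ _ _ _
      · rw [← hF]
        exact exp_mean₂_le (hg _ _ _ _ _ _)
    have h4 := mul_le_mul_of_nonneg_left h3 (Real.exp_pos (D 0 0 j)).le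
    rw [mul_one] at h4
    refine le_of_eq_of_le ?_ h4
    simp only [Finset.mul_sum]
    refine Finset.sum_congr rfl fun s _ => Finset.sum_congr rfl fun t _ =>
      Finset.sum_congr rfl fun i _ => ?_
    rw [← mul_assoc, ← Real.exp_add, mul_comm _ (a _ _ _ _), mul_left_comm, ← Real.exp_add]
    congr 2
    ring

end LogExcessive

/-! ### Spectral radius of nonnegative matrices and subinvariant vectors -/

section NonnegMatrix

variable {S : Type*} [Fintype S] [DecidableEq S]

theorem spectralRadius_le_of_forall_eigenvector {B : Matrix S S ℝ} {ρ : ℝ}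
    (h : ∀ (lam : ℂ) (z : S → ℂ), z ≠ 0 →
      (∀ i, ∑ j, (B i j : ℂ) * z j = lam * z i) → ‖lam‖ ≤ ρ) :
    spectralRadius ℂ (B.map (algebraMap ℝ ℂ)) ≤ ENNReal.ofReal ρ := by
  refine iSup₂_le fun lam hlam => ?_
  rw [← Matrix.spectrum_toLin', ← Module.End.hasEigenvalue_iff_mem_spectrum] at hlam
  obtain ⟨z, hz, hz0⟩ := hlam.exists_hasEigenvector
  rw [Module.End.mem_eigenspace_iff] at hz
  rw [← enorm_eq_nnnorm, ← ofReal_norm]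
  refine ENNReal.ofReal_le_ofReal (h lam z hz0 fun i => ?_)
  have := congrFun hz i
  simpa [Matrix.mulVec, dotProduct] using this

/-- A positive left vector `v` with `v B ≤ ρ v` bounds the spectral radius of a nonnegative
matrix `B` by `ρ`. -/
theorem spectralRadius_le_of_left {B : Matrix S S ℝ} (hB : ∀ i j, 0 ≤ B i j) {v : S → ℝ} {ρ : ℝ}
    (hv : ∀ i, 0 < v i) (h : ∀ j, ∑ i, v i * B i j ≤ ρ * v j) :
    spectralRadius ℂ (B.map (algebraMap ℝ ℂ)) ≤ ENNReal.ofReal ρ := by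
  refine spectralRadius_le_of_forall_eigenvector fun lam z hz hlam => ?_
  have hpos : 0 < ∑ i, v i * ‖z i‖ := by
    obtain ⟨i, hi⟩ := Function.ne_iff.1 hz
    exact Finset.sum_pos' (fun i _ => mul_nonneg (hv i).le (norm_nonneg _))
      ⟨i, Finset.mem_univ i, mul_pos (hv i) (norm_pos_iff.2 hi)⟩
  -- The eigenvalue is estimated in the weighted `ℓ¹` norm `∑ v i * ‖z i‖`; the case of a right
  -- vector uses the dual weighted sup norm.
  refine le_of_mul_le_mul_right ?_ hpos
  calc ‖lam‖ * ∑ i, v i * ‖z i‖ = ∑ i, v i * ‖∑ j, (B i j : ℂ) * z j‖ := by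
        rw [Finset.mul_sum]
        refine Finset.sum_congr rfl fun i _ => ?_
        rw [hlam, norm_mul]; ring
    _ ≤ ∑ i, v i * ∑ j, B i j * ‖z j‖ := by
        gcongr with i _
        · exact (hv i).le
        · refine (norm_sum_le _ _).trans_eq (Finset.sum_congr rfl fun j _ => ?_)
          rw [norm_mul, Complex.norm_real, Real.norm_of_nonneg (hB i j)]
    _ = ∑ j, (∑ i, v i * B i j) * ‖z j‖ := by
        simp only [Finset.mul_sum, Finset.sum_mul]
        rw [Finset.sum_comm]
        simp only [mul_assoc]
    _ ≤ ∑ j, ρ * v j * ‖z j‖ := by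
        gcongr with j _
        exact h j
    _ = ρ * ∑ i, v i * ‖z i‖ := by simp only [Finset.mul_sum, mul_assoc]

/-- A positive right vector `v` with `B v ≤ ρ v` bounds the spectral radius of a nonnegative
matrix `B` by `ρ`. -/
theorem spectralRadius_le_of_right {B : Matrix S S ℝ} (hB : ∀ i j, 0 ≤ B i j) {v : S → ℝ} {ρ : ℝ}
    (hv : ∀ i, 0 < v i) (h : ∀ i, ∑ j, B i j * v j ≤ ρ * v i) :
    spectralRadius ℂ (B.map (algebraMap ℝ ℂ)) ≤ ENNReal.ofReal ρ := by
  refine spectralRadius_le_of_forall_eigenvector fun lam z hz hlam => ?_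
  obtain ⟨i₀, hi₀⟩ := Function.ne_iff.1 hz
  have : Nonempty S := ⟨i₀⟩
  obtain ⟨i, hi⟩ := Finite.exists_max fun i => ‖z i‖ / v i
  set c := ‖z i‖ / v i
  have hc : 0 < c := (div_pos (norm_pos_iff.2 hi₀) (hv i₀)).trans_le (hi i₀)
  have hz : ∀ j, ‖z j‖ ≤ c * v j := fun j => (div_le_iff₀ (hv j)).1 (hi j)
  have hzi : ‖z i‖ = c * v i := (div_mul_cancel₀ _ (hv i).ne').symm
  refine le_of_mul_le_mul_right ?_ (mul_pos hc (hv i))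
  calc ‖lam‖ * (c * v i) = ‖∑ j, (B i j : ℂ) * z j‖ := by rw [hlam, norm_mul, hzi]
    _ ≤ ∑ j, B i j * ‖z j‖ := by
        refine (norm_sum_le _ _).trans_eq (Finset.sum_congr rfl fun j _ => ?_)
        rw [norm_mul, Complex.norm_real, Real.norm_of_nonneg (hB i j)]
    _ ≤ ∑ j, B i j * (c * v j) := by
        gcongr with j _
        · exact hB i j
        · exact hz j
    _ = c * ∑ j, B i j * v j := by
        rw [Finset.mul_sum]
        exact Finset.sum_congr rfl fun j _ => by ring
    _ ≤ c * (ρ * v i) := by gcongr; exact h i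
    _ = ρ * (c * v i) := by ring

/-- Gelfand's formula bounds `‖b ^ n‖` by `c ^ n` eventually, for some `c < 1`. -/
theorem tendsto_pow_of_spectralRadius_lt_one {B : Matrix S S ℝ}
    (h : spectralRadius ℂ (B.map (algebraMap ℝ ℂ)) < 1) (i j : S) :
    Tendsto (fun n => (B ^ n) i j) atTop (𝓝 0) := by
  let _ : NormedRing (Matrix S S ℂ) := Matrix.linftyOpNormedRing
  let _ : NormedAlgebra ℂ (Matrix S S ℂ) := Matrix.linftyOpNormedAlgebra
  have : CompleteSpace (Matrix S S ℂ) := FiniteDimensional.complete ℂ _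
  set b := B.map (algebraMap ℝ ℂ)
  obtain ⟨c, hc, hc1⟩ := exists_between h
  have hlim := spectrum.pow_nnnorm_pow_one_div_tendsto_nhds_spectralRadius b
  have hev : ∀ᶠ n : ℕ in atTop, (‖b ^ n‖₊ : ℝ≥0∞) ≤ c ^ n := by
    filter_upwards [hlim.eventually_lt_const hc, eventually_gt_atTop 0] with n hn hn0
    have hn' : (0 : ℝ) < n := by exact_mod_cast hn0
    have := ENNReal.rpow_le_rpow hn.le hn'.le
    rwa [← ENNReal.rpow_mul, one_div_mul_cancel hn'.ne', ENNReal.rpow_one,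
      ENNReal.rpow_natCast] at this
  have h3 : ∀ n, (b ^ n) i j = ((B ^ n) i j : ℂ) := fun n => by
    have : b ^ n = (B ^ n).map (algebraMap ℝ ℂ) := (Matrix.map_pow B (algebraMap ℝ ℂ) n).symm
    rw [this]; simp
  have h4 : ∀ n, ‖(B ^ n) i j‖ₑ ≤ (‖b ^ n‖₊ : ℝ≥0∞) := fun n => by
    have h5 : ‖(b ^ n) i j‖₊ ≤ ‖b ^ n‖₊ := by
      rw [Matrix.linfty_opNNNorm_def]
      exact (Finset.single_le_sum (f := fun j => ‖(b ^ n) i j‖₊) (fun _ _ => zero_le)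
        (Finset.mem_univ j)).trans
        (Finset.le_sup (f := fun i => ∑ j, ‖(b ^ n) i j‖₊) (Finset.mem_univ i))
    rw [h3, Complex.nnnorm_real] at h5
    exact_mod_cast h5
  rw [tendsto_zero_iff_enorm_tendsto_zero]
  exact tendsto_of_tendsto_of_tendsto_of_le_of_le' tendsto_const_nhds
    (ENNReal.tendsto_pow_atTop_nhds_zero_of_lt_one hc1) (Eventually.of_forall fun _ => bot_le)
    (hev.mono fun n hn => (h4 n).trans hn)

/-- A nonnegative matrix of spectral radius less than one has a strictly subinvariant positive
left vector. -/
theorem exists_left_of_spectralRadius_lt_one {B : Matrix S S ℝ} (hB : ∀ i j, 0 ≤ B i j)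
    (h : spectralRadius ℂ (B.map (algebraMap ℝ ℂ)) < 1) :
    ∃ (v : S → ℝ) (ρ : ℝ), (∀ i, 0 < v i) ∧ 0 ≤ ρ ∧ ρ < 1 ∧ ∀ j, ∑ i, v i * B i j ≤ ρ * v j := by
  have hBn : ∀ n i j, 0 ≤ (B ^ n) i j := fun n => by
    induction n with
    | zero => intro i j; rw [pow_zero, Matrix.one_apply]; split_ifs <;> norm_num
    | succ n ih =>
      intro i j
      rw [pow_succ, Matrix.mul_apply]
      exact Finset.sum_nonneg fun k _ => mul_nonneg (ih _ _) (hB _ _)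
  have hlim : ∀ j, ∀ᶠ n in atTop, ∑ i, (B ^ (n + 1)) i j ≤ 1 / 2 := fun j => by
    have : Tendsto (fun n => ∑ i, (B ^ n) i j) atTop (𝓝 0) := by
      simpa using tendsto_finsetSum Finset.univ
        fun i _ => tendsto_pow_of_spectralRadius_lt_one h i j
    exact ((this.comp (tendsto_add_atTop_nat 1)).eventually_lt_const
      (by norm_num : (0 : ℝ) < 1 / 2)).mono fun _ hn => hn.le
  obtain ⟨N, hN⟩ := (eventually_all.2 hlim).exists
  -- Column sums of a truncated Neumann series. Multiplication by `B` drops the term `n = 0`, worth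
  -- `1`, and adds the term `N + 1`, worth at most `1 / 2` by the choice of `N`.
  let v : S → ℝ := fun j => ∑ n ∈ Finset.range (N + 1), ∑ i, (B ^ n) i j
  have hv1 : ∀ j, 1 ≤ v j := fun j => by
    have h1 : ∑ i, (B ^ 0) i j = 1 := by simp [Matrix.one_apply]
    calc (1 : ℝ) = ∑ i, (B ^ 0) i j := h1.symm
      _ ≤ v j := Finset.single_le_sum (f := fun n => ∑ i, (B ^ n) i j)
        (fun n _ => Finset.sum_nonneg fun i _ => hBn n i j) (by simp)
  have hvB : ∀ j, ∑ i, v i * B i j ≤ v j - 1 / 2 := fun j => by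
    have h1 : ∑ i, v i * B i j = ∑ n ∈ Finset.range (N + 1), ∑ i, (B ^ (n + 1)) i j := by
      simp only [v, Finset.sum_mul, pow_succ, Matrix.mul_apply]
      rw [Finset.sum_comm]
      refine Finset.sum_congr rfl fun n _ => Finset.sum_comm
    have h2 := hN j
    have h3 := Finset.sum_range_succ' (fun n => ∑ i, (B ^ n) i j) (N + 1)
    have h4 := Finset.sum_range_succ (fun n => ∑ i, (B ^ n) i j) (N + 1)
    have h5 : ∑ i, (B ^ 0) i j = 1 := by simp [Matrix.one_apply]
    rw [h1]
    change _ ≤ ∑ n ∈ Finset.range (N + 1), ∑ i, (B ^ n) i j - 1 / 2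
    linarith
  set C := ∑ j, v j
  have hC : ∀ j, v j ≤ C := fun j =>
    Finset.single_le_sum (fun j _ => zero_le_one.trans (hv1 j)) (Finset.mem_univ j)
  have hC0 : 0 ≤ C := Finset.sum_nonneg fun j _ => zero_le_one.trans (hv1 j)
  -- The absolute gain `1 / 2` becomes a uniform factor because `v j ≤ C`; the `+ 1` keeps the
  -- denominator positive when `S` is empty.
  refine ⟨v, 1 - 1 / (2 * (C + 1)), fun i => zero_lt_one.trans_le (hv1 i), ?_, ?_, fun j => ?_⟩
  · rw [sub_nonneg, div_le_one (by positivity)]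
    linarith
  · exact sub_lt_self _ (by positivity)
  · refine (hvB j).trans ?_
    have h1 : 1 / (2 * (C + 1)) * v j ≤ 1 / 2 := by
      rw [div_mul_eq_mul_div, div_le_div_iff₀ (by positivity) (by positivity)]
      linarith [hC j]
    linarith

end NonnegMatrix

/-! ### Convexity of the matrix moment generating function -/

namespace MMRW

theorem sum_neg_one_zero_one {M : Type*} [AddCommMonoid M] (f : ℤ → M) :
    ∑ k ∈ ({-1, 0, 1} : Finset ℤ), f k = ∑ s : Fin 3, f (1 - ((s : ℕ) : ℤ)) := by
  rw [Finset.sum_insert (by decide), Finset.sum_insert (by decide), Finset.sum_singleton,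
    Fin.sum_univ_three]
  norm_num
  abel

variable {S₀ : Type*} (W : MMRW S₀)

theorem Areal_nonneg (k l : ℤ) (i j : S₀) : 0 ≤ W.Areal k l i j := ENNReal.toReal_nonneg

theorem Amgf_apply (θ : ℝ × ℝ) (i j : S₀) :
    W.Amgf θ i j = ∑ s : Fin 3, ∑ t : Fin 3,
      Real.exp ((1 - (s : ℕ)) * θ.1 + (1 - (t : ℕ)) * θ.2) *
        W.Areal (1 - (s : ℕ)) (1 - (t : ℕ)) i j := by
  simp only [Amgf, sum_neg_one_zero_one, Matrix.sum_apply, Matrix.smul_apply, smul_eq_mul]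
  push_cast
  rfl

theorem Amgf_nonneg (θ : ℝ × ℝ) (i j : S₀) : 0 ≤ W.Amgf θ i j := by
  rw [Amgf_apply]
  exact Finset.sum_nonneg fun s _ => Finset.sum_nonneg fun t _ =>
    mul_nonneg (Real.exp_pos _).le (W.Areal_nonneg _ _ _ _)

variable [Fintype S₀]

/-- Interpolating the logarithms of the two vectors linearly makes every summand of the ratio `u i *
A i j / u j` an exponential of an affine function of `t`, to which convexity of `exp` applies. -/
theorem Amgf_convex {θ θ' : ℝ × ℝ} {v v' : S₀ → ℝ} {ρ ρ' t : ℝ} (hv : ∀ i, 0 < v i)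
    (hv' : ∀ i, 0 < v' i) (h : ∀ j, ∑ i, v i * W.Amgf θ i j ≤ ρ * v j)
    (h' : ∀ j, ∑ i, v' i * W.Amgf θ' i j ≤ ρ' * v' j) (ht : 0 ≤ t) (ht1 : t ≤ 1) :
    ∃ u : S₀ → ℝ, (∀ i, 0 < u i) ∧
      ∀ j, ∑ i, u i * W.Amgf ((1 - t) • θ + t • θ') i j ≤ ((1 - t) * ρ + t * ρ') * u j := by
  let u : S₀ → ℝ := fun i => Real.exp ((1 - t) * Real.log (v i) + t * Real.log (v' i))
  have hle : ∀ i j, u i * W.Amgf ((1 - t) • θ + t • θ') i j ≤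
      ((1 - t) * (v i / v j * W.Amgf θ i j) + t * (v' i / v' j * W.Amgf θ' i j)) * u j := by
    intro i j
    simp only [Amgf_apply, Finset.mul_sum, Finset.sum_mul, ← Finset.sum_add_distrib]
    refine Finset.sum_le_sum fun s _ => Finset.sum_le_sum fun r _ => ?_
    set a := W.Areal (1 - (s : ℕ)) (1 - (r : ℕ)) i j
    have ha : 0 ≤ a := W.Areal_nonneg _ _ _ _
    set x := Real.log (v i) - Real.log (v j) + ((1 - (s : ℕ)) * θ.1 + (1 - (r : ℕ)) * θ.2)
    set y := Real.log (v' i) - Real.log (v' j) + ((1 - (s : ℕ)) * θ'.1 + (1 - (r : ℕ)) * θ'.2)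
    have hx : v i / v j * Real.exp ((1 - (s : ℕ)) * θ.1 + (1 - (r : ℕ)) * θ.2) = Real.exp x := by
      rw [show Real.exp x = _ from Real.exp_add _ _, Real.exp_sub, Real.exp_log (hv i),
        Real.exp_log (hv j)]
    have hy : v' i / v' j * Real.exp ((1 - (s : ℕ)) * θ'.1 + (1 - (r : ℕ)) * θ'.2)
        = Real.exp y := by
      rw [show Real.exp y = _ from Real.exp_add _ _, Real.exp_sub, Real.exp_log (hv' i),
        Real.exp_log (hv' j)]
    have hc := convexOn_exp.2 (Set.mem_univ x) (Set.mem_univ y) (sub_nonneg.2 ht1) ht (by ring)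
    simp only [smul_eq_mul] at hc
    have hl : u i * (Real.exp ((1 - (s : ℕ)) * ((1 - t) • θ + t • θ').1 +
        (1 - (r : ℕ)) * ((1 - t) • θ + t • θ').2) * a)
        = Real.exp ((1 - t) * x + t * y) * a * u j := by
      rw [← mul_assoc, mul_right_comm _ a, ← Real.exp_add, ← Real.exp_add]
      congr 2
      simp only [Prod.fst_add, Prod.snd_add, Prod.smul_fst, Prod.smul_snd, smul_eq_mul, x, y]
      ring
    rw [hl, ← mul_assoc (v i / v j), hx, ← mul_assoc (v' i / v' j), hy]
    have := mul_le_mul_of_nonneg_right (mul_le_mul_of_nonneg_right hc ha) (Real.exp_pos _ : 0 < u j).le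
    linarith
  refine ⟨u, fun i => Real.exp_pos _, fun j => ?_⟩
  refine (Finset.sum_le_sum fun i _ => hle i j).trans ?_
  rw [← Finset.sum_mul, Finset.sum_add_distrib, ← Finset.mul_sum, ← Finset.mul_sum]
  have e1 : ∑ i, v i / v j * W.Amgf θ i j ≤ ρ := by
    simp only [div_mul_eq_mul_div, ← Finset.sum_div]
    exact (div_le_iff₀ (hv j)).2 (h j)
  have e2 : ∑ i, v' i / v' j * W.Amgf θ' i j ≤ ρ' := by
    simp only [div_mul_eq_mul_div, ← Finset.sum_div]
    exact (div_le_iff₀ (hv' j)).2 (h' j)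
  have := sub_nonneg.2 ht1
  have := (Real.exp_pos _ : 0 < u j).le
  gcongr

variable [DecidableEq S₀]

theorem exists_left_of_mem_Gam {θ : ℝ × ℝ} (hθ : θ ∈ W.Gam) :
    ∃ (v : S₀ → ℝ) (ρ : ℝ), (∀ i, 0 < v i) ∧ 0 ≤ ρ ∧ ρ < 1 ∧
      ∀ j, ∑ i, v i * W.Amgf θ i j ≤ ρ * v j :=
  exists_left_of_spectralRadius_lt_one (W.Amgf_nonneg θ) hθ

/-- On the segment from `θ` to a point of `Γ` the bound interpolates between `1` and some `ρ < 1`,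
so every point of it other than `θ` lies in `Γ`. -/
theorem mem_closure_Gam {θ : ℝ × ℝ} {v : S₀ → ℝ} (hv : ∀ i, 0 < v i)
    (h : ∀ j, ∑ i, v i * W.Amgf θ i j ≤ v j) (hne : W.Gam.Nonempty) :
    θ ∈ closure W.Gam := by
  obtain ⟨θ', hθ'⟩ := hne
  obtain ⟨v', ρ, hv', -, hρ1, h'⟩ := W.exists_left_of_mem_Gam hθ'
  have hmem : ∀ n : ℕ, (1 - 1 / ((n : ℝ) + 1)) • θ + (1 / ((n : ℝ) + 1)) • θ' ∈ W.Gam := fun n => by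
    have hp : 0 < 1 / ((n : ℝ) + 1) := by positivity
    have h1 : 1 / ((n : ℝ) + 1) ≤ 1 := by
      rw [div_le_one (by positivity)]; linarith [(n.cast_nonneg : (0 : ℝ) ≤ n)]
    obtain ⟨u, hu, hu'⟩ := W.Amgf_convex (ρ := 1) hv hv' (by simpa using h) h' hp.le h1
    refine (spectralRadius_le_of_left (W.Amgf_nonneg _) hu hu').trans_lt ?_
    rw [ENNReal.ofReal_lt_one]
    nlinarith
  refine mem_closure_of_tendsto (b := atTop) ?_ (Eventually.of_forall hmem)
  have hlim := tendsto_one_div_add_atTop_nhds_zero_nat (𝕜 := ℝ)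
  have := ((hlim.const_sub 1).smul_const θ).add (hlim.smul_const θ')
  simpa using this

end MMRW

/-! ### Subinvariant vectors and the convergence parameter -/

namespace NNMat

variable {ι : Type*}

/-- The product of a row vector and a matrix. -/
noncomputable def vmul (x : ι → ℝ≥0∞) (M : NNMat ι) : ι → ℝ≥0∞ := fun j => ∑' i, x i * M i j

theorem vmul_vmul (x : ι → ℝ≥0∞) (M N : NNMat ι) : vmul (vmul x M) N = vmul x (mul M N) := by
  funext j
  simp only [vmul, mul, ← ENNReal.tsum_mul_right, ← ENNReal.tsum_mul_left, mul_assoc]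
  exact ENNReal.tsum_comm

theorem mul_apply_eq_vmul (M N : NNMat ι) (i : ι) : mul M N i = vmul (M i) N := rfl

protected theorem mul_assoc (L M N : NNMat ι) : mul (mul L M) N = mul L (mul M N) := by
  funext i
  exact vmul_vmul (L i) M N

theorem vmul_id (x : ι → ℝ≥0∞) : vmul x id = x := by
  classical
  funext j
  simp only [vmul, id]
  rw [tsum_eq_single j fun i hi => by simp [hi]]
  simp

theorem id_mul (M : NNMat ι) : mul id M = M := by
  classical
  funext i j
  simp only [mul, id]
  rw [tsum_eq_single i fun k hk => by simp [hk.symm]]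
  simp

theorem vmul_add (x : ι → ℝ≥0∞) (M N : NNMat ι) : vmul x (M + N) = vmul x M + vmul x N := by
  funext j
  simp only [vmul, Pi.add_apply, mul_add, ENNReal.tsum_add]

protected theorem mul_add (L M N : NNMat ι) : mul L (M + N) = mul L M + mul L N :=
  funext fun i => vmul_add (L i) M N

theorem vmul_smul (c : ℝ≥0∞) (x : ι → ℝ≥0∞) (M : NNMat ι) :
    vmul (fun i => c * x i) M = fun j => c * vmul x M j := by
  funext j
  simp only [vmul, mul_assoc, ENNReal.tsum_mul_left]

theorem vmul_mono {x y : ι → ℝ≥0∞} {M N : NNMat ι} (h : x ≤ y) (h' : M ≤ N) :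
    vmul x M ≤ vmul y N :=
  fun _ => ENNReal.tsum_le_tsum fun i => mul_le_mul' (h i) (h' i _)

theorem mul_mono {L L' M M' : NNMat ι} (h : L ≤ L') (h' : M ≤ M') : mul L M ≤ mul L' M' :=
  fun i => vmul_mono (h i) h'

theorem pow_one (M : NNMat ι) : pow M 1 = M := id_mul M

theorem le_vmul (x : ι → ℝ≥0∞) (M : NNMat ι) (i j : ι) : x i * M i j ≤ vmul x M j :=
  ENNReal.le_tsum i

theorem vmul_pow_le {x : ι → ℝ≥0∞} {M : NNMat ι} {c : ℝ≥0∞} (h : ∀ j, vmul x M j ≤ c * x j)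
    (n : ℕ) (j : ι) : vmul x (pow M n) j ≤ c ^ n * x j := by
  induction n generalizing j with
  | zero => simp [pow, vmul_id]
  | succ n ih =>
    calc vmul x (pow M (n + 1)) j = vmul (vmul x (pow M n)) M j := by rw [vmul_vmul]; rfl
      _ ≤ vmul (fun i => c ^ n * x i) M j := vmul_mono ih le_rfl j
      _ = c ^ n * vmul x M j := by rw [vmul_smul]
      _ ≤ c ^ n * (c * x j) := by gcongr; exact h j
      _ = c ^ (n + 1) * x j := by rw [pow_succ, mul_assoc]

theorem pow_apply_le {x : ι → ℝ≥0∞} {M : NNMat ι} {c : ℝ≥0∞} (h : ∀ j, vmul x M j ≤ c * x j)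
    (n : ℕ) (i j : ι) : x i * pow M n i j ≤ c ^ n * x j :=
  (le_vmul x _ i j).trans (vmul_pow_le h n j)

/-- Iterating `x M ≤ c x` gives `x i * M ^ n i j ≤ c ^ n * x j`, a geometric bound. -/
theorem tsum_pow_lt_top {x : ι → ℝ≥0∞} {M : NNMat ι} {c s : ℝ≥0∞}
    (h : ∀ j, vmul x M j ≤ c * x j) (hx : ∀ i, x i ≠ 0) (hx' : ∀ i, x i ≠ ∞) (hs : s * c < 1)
    (i j : ι) : ∑' n, s ^ n * pow M n i j < ∞ := by
  have h1 : x i * ∑' n, s ^ n * pow M n i j ≤ ∑' n, (s * c) ^ n * x j := by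
    rw [← ENNReal.tsum_mul_left]
    refine ENNReal.tsum_le_tsum fun n => ?_
    rw [mul_left_comm, mul_pow, mul_assoc]
    exact mul_le_mul' le_rfl (pow_apply_le h n i j)
  rw [ENNReal.tsum_mul_right, ENNReal.tsum_geometric] at h1
  have h2 : (1 - s * c)⁻¹ * x j < ∞ :=
    ENNReal.mul_lt_top (ENNReal.inv_lt_top.2 (tsub_pos_of_lt hs)) (hx' j).lt_top
  by_contra h3
  rw [not_lt, top_le_iff] at h3
  rw [h3, ENNReal.mul_top (hx i)] at h1
  exact h2.not_ge h1

theorem le_cp {x : ι → ℝ≥0∞} {M : NNMat ι} {c : ℝ≥0∞}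
    (h : ∀ j, vmul x M j ≤ c * x j) (hx : ∀ i, x i ≠ 0) (hx' : ∀ i, x i ≠ ∞) :
    c⁻¹ ≤ cp M := by
  refine le_of_forall_lt fun s hs => ?_
  lift s to ℝ≥0 using hs.ne_top
  obtain ⟨r, hsr, hr⟩ := ENNReal.lt_iff_exists_nnreal_btwn.1 hs
  refine hsr.trans_le (le_iSup₂_of_le r (fun i j => ?_) le_rfl)
  refine tsum_pow_lt_top h hx hx' ?_ i j
  rcases eq_or_ne c 0 with rfl | hc
  · simp
  rcases eq_or_ne c ∞ with rfl | hc'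
  · simp at hr
  calc (r : ℝ≥0∞) * c < c⁻¹ * c := by
        rw [ENNReal.mul_lt_mul_iff_left hc hc']; exact hr
    _ = 1 := ENNReal.inv_mul_cancel hc hc'

theorem tsum_iSup_of_monotone {f : ℕ → ι → ℝ≥0∞} (hf : Monotone f) :
    ∑' i, ⨆ n, f n i = ⨆ n, ∑' i, f n i := by
  simp only [ENNReal.tsum_eq_iSup_sum]
  rw [iSup_comm]
  congr 1
  funext s
  exact ENNReal.finsetSum_iSup_of_monotone fun i m n h => hf h i

theorem iSup_mul_iSup_of_monotone {f g : ℕ → ℝ≥0∞} (hf : Monotone f) (hg : Monotone g) :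
    (⨆ n, f n) * ⨆ n, g n = ⨆ n, f n * g n := by
  refine le_antisymm ?_ (iSup_le fun n => mul_le_mul' (le_iSup f n) (le_iSup g n))
  simp only [ENNReal.iSup_mul, ENNReal.mul_iSup]
  exact iSup_le fun m => iSup_le fun n => le_iSup_of_le (max m n)
    (mul_le_mul' (hf (by simp)) (hg (by simp)))

theorem mul_iSup {L M : ℕ → NNMat ι} (hL : Monotone L) (hM : Monotone M) (i j : ι) :
    mul (fun i j => ⨆ n, L n i j) (fun i j => ⨆ n, M n i j) i j = ⨆ n, mul (L n) (M n) i j := by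
  simp only [mul]
  rw [← tsum_iSup_of_monotone (f := fun n k => L n i k * M n k j)
    fun m n h k => mul_le_mul' (hL h i k) (hM h k j)]
  congr 1
  funext k
  exact iSup_mul_iSup_of_monotone (fun m n h => hL h i k) fun m n h => hM h k j

/-! ### The minimal solution of the rate equation -/

section Rate

variable (Bneg Bzero Bpos : NNMat ι)

/-- The monotone iteration for the equation `R = R² B₋₁ + R B₀ + B₁`. -/
noncomputable def rateIter : ℕ → NNMat ι
  | 0 => 0
  | n + 1 => mul (mul (rateIter n) (rateIter n)) Bneg + mul (rateIter n) Bzero + Bpos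

/-- The limit of the monotone iteration for the equation `R = R² B₋₁ + R B₀ + B₁`. -/
noncomputable def rate : NNMat ι := fun i j => ⨆ n, rateIter Bneg Bzero Bpos n i j

theorem rateIter_mono : Monotone (rateIter Bneg Bzero Bpos) := by
  refine monotone_nat_of_le_succ fun n => ?_
  induction n with
  | zero => exact fun _ _ => bot_le
  | succ n ih =>
    exact add_le_add (add_le_add (mul_mono (mul_mono ih ih) le_rfl) (mul_mono ih le_rfl)) le_rfl

/-- Monotone convergence passes to the limit in the recursion; in `[0, ∞]` no finiteness is needed.
-/
theorem rate_eq : rate Bneg Bzero Bpos =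
    mul (mul (rate Bneg Bzero Bpos) (rate Bneg Bzero Bpos)) Bneg +
      mul (rate Bneg Bzero Bpos) Bzero + Bpos := by
  set I := rateIter Bneg Bzero Bpos
  have hI : Monotone I := rateIter_mono Bneg Bzero Bpos
  have hII : Monotone fun n => mul (I n) (I n) := fun m n h => mul_mono (hI h) (hI h)
  have hc : ∀ B : NNMat ι, B = fun i j => ⨆ _ : ℕ, B i j := fun B => by simp
  have h1 : mul (rate Bneg Bzero Bpos) (rate Bneg Bzero Bpos) =
      fun i j => ⨆ n, mul (I n) (I n) i j := funext fun i => funext fun j => mul_iSup hI hI i j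
  funext i j
  have h2 : mul (mul (rate Bneg Bzero Bpos) (rate Bneg Bzero Bpos)) Bneg i j =
      ⨆ n, mul (mul (I n) (I n)) Bneg i j := by
    rw [h1, hc Bneg, mul_iSup hII monotone_const]
    simp only [ciSup_const]
  have h3 : mul (rate Bneg Bzero Bpos) Bzero i j = ⨆ n, mul (I n) Bzero i j := by
    have := mul_iSup hI (monotone_const (c := Bzero)) i j
    simp only [ciSup_const] at this
    exact this
  rw [Pi.add_apply, Pi.add_apply, Pi.add_apply, Pi.add_apply, h2, h3,
    ENNReal.iSup_add_iSup_of_monotone (fun m n h => mul_mono (hII h) le_rfl i j)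
      (fun m n h => mul_mono (hI h) le_rfl i j), ENNReal.iSup_add]
  refine le_antisymm (iSup_le fun n => ?_) (iSup_le fun n => ?_)
  · exact le_iSup_of_le n (rateIter_mono Bneg Bzero Bpos n.le_succ i j)
  · exact le_iSup_of_le (n + 1) le_rfl

theorem rate_le {X : NNMat ι} (hX : X = mul (mul X X) Bneg + mul X Bzero + Bpos) :
    rate Bneg Bzero Bpos ≤ X := by
  refine fun i j => iSup_le fun n => ?_
  suffices h : rateIter Bneg Bzero Bpos n ≤ X from h i j
  induction n with
  | zero => exact fun _ _ => bot_le
  | succ n ih =>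
    rw [hX]
    exact add_le_add (add_le_add (mul_mono (mul_mono ih ih) le_rfl) (mul_mono ih le_rfl)) le_rfl

variable {Bneg Bzero Bpos}

/-- The hypothesis propagates `x I ≤ c x` along the iteration, since the quadratic term costs `c *
c` and the linear one `c`. -/
theorem vmul_rate_le {x : ι → ℝ≥0∞} {c : ℝ≥0∞}
    (h : ∀ j, c * c * vmul x Bneg j + c * vmul x Bzero j + vmul x Bpos j ≤ c * x j) (j : ι) :
    vmul x (rate Bneg Bzero Bpos) j ≤ c * x j := by
  set I := rateIter Bneg Bzero Bpos
  have hI : Monotone I := rateIter_mono Bneg Bzero Bpos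
  have h1 : vmul x (rate Bneg Bzero Bpos) j = ⨆ n, vmul x (I n) j := by
    simp only [vmul, rate]
    rw [← tsum_iSup_of_monotone (f := fun n k => x k * I n k j)
      fun m n h k => mul_le_mul' le_rfl (hI h k j)]
    simp only [ENNReal.mul_iSup, I]
  rw [h1]
  clear h1
  refine iSup_le fun n => ?_
  induction n generalizing j with
  | zero => simp [I, rateIter, vmul]
  | succ n ih =>
    change vmul x (mul (mul (I n) (I n)) Bneg + mul (I n) Bzero + Bpos) j ≤ _
    rw [vmul_add, vmul_add, ← vmul_vmul, ← vmul_vmul, ← vmul_vmul]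
    refine le_trans ?_ (h j)
    have h3 : vmul x (I n) ≤ fun j => c * x j := ih
    have h4 : vmul (vmul x (I n)) (I n) ≤ fun j => c * c * x j := fun j => by
      refine (vmul_mono h3 le_rfl j).trans ?_
      rw [vmul_smul]
      simp only [mul_assoc]
      exact mul_le_mul' le_rfl (ih j)
    refine add_le_add (add_le_add ?_ ?_) le_rfl
    · exact (vmul_mono h4 le_rfl j).trans_eq (by rw [vmul_smul])
    · exact (vmul_mono h3 le_rfl j).trans_eq (by rw [vmul_smul])

/-- A positive finite subinvariant vector supplies what minimality in `[0, ∞]` leaves open, the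
finiteness of the entries. -/
theorem isRateMatrix_rate {x : ι → ℝ≥0∞} {c : ℝ≥0∞} (hc : c ≠ ∞) (hx : ∀ i, x i ≠ 0)
    (hx' : ∀ i, x i ≠ ∞)
    (h : ∀ j, c * c * vmul x Bneg j + c * vmul x Bzero j + vmul x Bpos j ≤ c * x j) :
    IsRateMatrix Bneg Bzero Bpos (rate Bneg Bzero Bpos) := by
  refine ⟨⟨fun i j => ?_, rate_eq _ _ _⟩, fun X hX => rate_le _ _ _ hX.2⟩
  have h1 := (le_vmul x _ i j).trans (vmul_rate_le h j)
  by_contra h3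
  rw [not_lt, top_le_iff] at h3
  rw [h3, ENNReal.mul_top (hx i)] at h1
  exact (ENNReal.mul_lt_top hc.lt_top (hx' j).lt_top).not_ge h1

/-- The powers of a solution of the rate equation satisfy a three-term recursion. -/
theorem IsRateMatrix.pow_eq {R : NNMat ι} (hR : IsRateMatrix Bneg Bzero Bpos R) (k : ℕ) :
    pow R (k + 1) = mul (pow R (k + 2)) Bneg + mul (pow R (k + 1)) Bzero + mul (pow R k) Bpos := by
  change mul (pow R k) R = _
  rw [congrArg (mul (pow R k)) hR.1.2, NNMat.mul_add, NNMat.mul_add, ← NNMat.mul_assoc, ← NNMat.mul_assoc, ← NNMat.mul_assoc]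
  rfl

end Rate

end NNMat

/-! ### Exponential weights and boundedness of `Γ` -/

namespace MMRW

open NNMat

variable {S₀ : Type*} (W : MMRW S₀)

theorem P_eq_A (x₁ x₂ y₁ y₂ : ℤ) (i j : S₀) :
    W.P (x₁, x₂, i) (y₁, y₂, j) = W.A (y₁ - x₁) (y₂ - x₂) i j := by
  have := W.homogeneous x₁ x₂ 0 0 (y₁ - x₁) (y₂ - x₂) i j
  simpa [A, P] using this

theorem Pplus_eq_A (x₁ x₂ y₁ y₂ : ℕ) (i j : S₀) :
    W.Pplus (x₁, x₂, i) (y₁, y₂, j) = W.A (y₁ - x₁) (y₂ - x₂) i j :=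
  W.P_eq_A _ _ _ _ _ _

theorem A_eq_zero_left {k : ℤ} (hk : k ∉ ({-1, 0, 1} : Set ℤ)) (l : ℤ) (i j : S₀) :
    W.A k l i j = 0 := by
  by_contra h
  exact hk (by simpa using (W.skipFree 0 0 i k l j h).1)

theorem A_eq_zero_right {l : ℤ} (hl : l ∉ ({-1, 0, 1} : Set ℤ)) (k : ℤ) (i j : S₀) :
    W.A k l i j = 0 := by
  by_contra h
  exact hl (by simpa using (W.skipFree 0 0 i k l j h).2)

theorem A_ne_top (k l : ℤ) (i j : S₀) : W.A k l i j ≠ ∞ := PMF.apply_ne_top _ _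

theorem ofReal_Areal (k l : ℤ) (i j : S₀) : ENNReal.ofReal (W.Areal k l i j) = W.A k l i j :=
  ENNReal.ofReal_toReal (W.A_ne_top k l i j)

/-- The exponential weight `e^{-⟨θ, x⟩} v_j` on `ℤ² × S₀`. -/
noncomputable def expWeight (θ : ℝ × ℝ) (v : S₀ → ℝ) (y : MMRWState S₀) : ℝ≥0∞ :=
  ENNReal.ofReal (Real.exp (-(y.1 * θ.1 + y.2.1 * θ.2)) * v y.2.2)

theorem expWeight_ne_zero {θ : ℝ × ℝ} {v : S₀ → ℝ} (hv : ∀ i, 0 < v i) (y : MMRWState S₀) :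
    expWeight θ v y ≠ 0 := by
  simpa [expWeight] using mul_pos (Real.exp_pos _) (hv _)

theorem expWeight_ne_top (θ : ℝ × ℝ) (v : S₀ → ℝ) (y : MMRWState S₀) :
    expWeight θ v y ≠ ∞ := ENNReal.ofReal_ne_top

theorem mem_offsets {k : ℤ} (h : k ∈ ({-1, 0, 1} : Set ℤ)) : ∃ s : Fin 3, k = 1 - ((s : ℕ) : ℤ) := by
  rcases h with rfl | rfl | rfl
  · exact ⟨2, by norm_num⟩
  · exact ⟨1, by norm_num⟩
  · exact ⟨0, by norm_num⟩

theorem emb_injective : Function.Injective (emb : MMRWQuad S₀ → MMRWState S₀) := by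
  rintro ⟨x₁, x₂, i⟩ ⟨y₁, y₂, j⟩ h
  simpa [emb] using h

section Finite

variable [Fintype S₀]

/-- A predecessor displaced by `-(k, l)` carries the extra factor `e^{k θ₁ + l θ₂}`, so the sum over
predecessors reassembles `v A(θ)`. -/
theorem vmul_expWeight_P {θ : ℝ × ℝ} {v : S₀ → ℝ} (hv : ∀ i, 0 < v i) {ρ : ℝ}
    (h : ∀ j, ∑ i, v i * W.Amgf θ i j ≤ ρ * v j) (y : MMRWState S₀) :
    vmul (expWeight θ v) W.P y ≤ ENNReal.ofReal ρ * expWeight θ v y := by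
  obtain ⟨y₁, y₂, j⟩ := y
  let e : Fin 3 × Fin 3 × S₀ → MMRWState S₀ := fun p =>
    (y₁ - (1 - ((p.1 : ℕ) : ℤ)), y₂ - (1 - ((p.2.1 : ℕ) : ℤ)), p.2.2)
  have he : Function.Injective e := by
    rintro ⟨s, t, i⟩ ⟨s', t', i'⟩ h
    simp only [e, Prod.mk.injEq] at h
    obtain ⟨h1, h2, h3⟩ := h
    simp only [Prod.mk.injEq, Fin.ext_iff]
    exact ⟨by lia, by lia, h3⟩
  have hsupp : Function.support (fun x => expWeight θ v x * W.P x (y₁, y₂, j)) ⊆ Set.range e := by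
    rintro ⟨x₁, x₂, i⟩ hx
    have hP : W.step (x₁, x₂, i) (y₁, y₂, j) ≠ 0 := right_ne_zero_of_mul hx
    obtain ⟨h1, h2⟩ := W.skipFree _ _ _ _ _ _ hP
    obtain ⟨s, hs⟩ := mem_offsets h1
    obtain ⟨t, ht⟩ := mem_offsets h2
    refine ⟨(s, t, i), ?_⟩
    simp only [e, Prod.mk.injEq, and_true]
    exact ⟨by lia, by lia⟩
  have hterm : ∀ p : Fin 3 × Fin 3 × S₀, expWeight θ v (e p) * W.P (e p) (y₁, y₂, j) =
      ENNReal.ofReal (Real.exp (-(y₁ * θ.1 + y₂ * θ.2)) * (v p.2.2 *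
        (Real.exp ((1 - (p.1 : ℕ)) * θ.1 + (1 - (p.2.1 : ℕ)) * θ.2) *
        W.Areal (1 - (p.1 : ℕ)) (1 - (p.2.1 : ℕ)) p.2.2 j))) := by
    rintro ⟨s, t, i⟩
    simp only [e, expWeight, P_eq_A, sub_sub_cancel]
    rw [← ofReal_Areal, ← ENNReal.ofReal_mul (mul_nonneg (Real.exp_pos _).le (hv i).le)]
    congr 1
    have hexp : Real.exp (-(((y₁ - (1 - ((s : ℕ) : ℤ)) : ℤ) : ℝ) * θ.1 +
        ((y₂ - (1 - ((t : ℕ) : ℤ)) : ℤ) : ℝ) * θ.2)) =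
        Real.exp (-(y₁ * θ.1 + y₂ * θ.2)) *
          Real.exp ((1 - (s : ℕ)) * θ.1 + (1 - (t : ℕ)) * θ.2) := by
      rw [← Real.exp_add]
      congr 1
      push_cast
      ring
    rw [hexp]
    ring
  have hsum : vmul (expWeight θ v) W.P (y₁, y₂, j) =
      ENNReal.ofReal (Real.exp (-(y₁ * θ.1 + y₂ * θ.2)) * ∑ i, v i * W.Amgf θ i j) := by
    simp only [vmul]
    rw [← he.tsum_eq hsupp, tsum_fintype]
    simp only [hterm]
    rw [← ENNReal.ofReal_sum_of_nonneg fun p _ => mul_nonneg (Real.exp_pos _).le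
      (mul_nonneg (hv _).le (mul_nonneg (Real.exp_pos _).le (W.Areal_nonneg _ _ _ _)))]
    congr 1
    rw [← Finset.mul_sum]
    congr 1
    simp only [Amgf_apply, Finset.mul_sum, Fintype.sum_prod_type]
    rw [Finset.sum_comm' (t' := Finset.univ) (s' := fun _ => Finset.univ) (by simp)]
    conv_lhs => enter [2, t]; rw [Finset.sum_comm]
    conv_rhs => enter [2, i]; rw [Finset.sum_comm]
    rw [Finset.sum_comm]
  rw [hsum]
  -- `ENNReal.ofReal` truncates negative `ρ`, but such `ρ` cannot occur since `v A(θ) ≥ 0`.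
  rcases lt_or_ge ρ 0 with hρ | hρ
  · exfalso
    have h1 : 0 ≤ ∑ i, v i * W.Amgf θ i j :=
      Finset.sum_nonneg fun i _ => mul_nonneg (hv i).le (W.Amgf_nonneg _ _ _)
    exact absurd (h j) (not_le.2 ((mul_neg_of_neg_of_pos hρ (hv j)).trans_le h1))
  rw [expWeight, ← ENNReal.ofReal_mul hρ]
  refine ENNReal.ofReal_le_ofReal ?_
  rw [mul_left_comm]
  exact mul_le_mul_of_nonneg_left (h j) (Real.exp_pos _).le

theorem vmul_expWeight_Pplus {θ : ℝ × ℝ} {v : S₀ → ℝ} (hv : ∀ i, 0 < v i) {ρ : ℝ}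
    (h : ∀ j, ∑ i, v i * W.Amgf θ i j ≤ ρ * v j) (y : MMRWQuad S₀) :
    vmul (fun y => expWeight θ v (emb y)) W.Pplus y ≤ ENNReal.ofReal ρ * expWeight θ v (emb y) :=
  (ENNReal.tsum_comp_le_tsum_of_injective emb_injective
    fun x => expWeight θ v x * W.P x (emb y)).trans (W.vmul_expWeight_P hv h (emb y))

variable [DecidableEq S₀]

/-- A path of probability `p` from the origin to `(k, l)` that returns to the same phase lets `v j`
cancel, which leaves `p ≤ e^{-(k θ₁ + l θ₂)}`. -/
theorem exists_bound_Gam [Nonempty S₀] (hP : W.P.Irreducible) (k l : ℤ) :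
    ∃ C : ℝ, ∀ θ ∈ W.Gam, k * θ.1 + l * θ.2 ≤ C := by
  obtain ⟨j⟩ := ‹Nonempty S₀›
  obtain ⟨n, -, hn⟩ := hP (0, 0, j) (k, l, j)
  set p := pow W.P n (0, 0, j) (k, l, j)
  refine ⟨-Real.log p.toReal, fun θ hθ => ?_⟩
  obtain ⟨v, ρ, hv, hρ0, hρ1, h⟩ := W.exists_left_of_mem_Gam hθ
  have h1 := pow_apply_le (W.vmul_expWeight_P hv h) n (0, 0, j) (k, l, j)
  have h2 : ENNReal.ofReal ρ ^ n ≤ 1 := pow_le_one' (by simpa using hρ1.le) n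
  have h3 : expWeight θ v (0, 0, j) * p ≤ expWeight θ v (k, l, j) :=
    h1.trans (mul_le_of_le_one_left' h2)
  have hp : p ≠ ∞ := fun hp => by
    rw [hp, ENNReal.mul_top (expWeight_ne_zero hv _), top_le_iff] at h3
    exact expWeight_ne_top _ _ _ h3
  have hp' : 0 < p.toReal := ENNReal.toReal_pos hn.ne' hp
  have h4 := ENNReal.toReal_mono (expWeight_ne_top _ _ _) h3
  rw [ENNReal.toReal_mul, expWeight, expWeight, ENNReal.toReal_ofReal
    (mul_nonneg (Real.exp_pos _).le (hv _).le), ENNReal.toReal_ofReal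
    (mul_nonneg (Real.exp_pos _).le (hv _).le)] at h4
  simp only [Int.cast_zero, zero_mul, add_zero, neg_zero, Real.exp_zero, one_mul] at h4
  rw [mul_comm] at h4
  have h5 := le_of_mul_le_mul_right h4 (hv j)
  have h6 := (Real.log_le_iff_le_exp hp').2 h5
  linarith

theorem isBounded_Gam [Nonempty S₀] (hP : W.P.Irreducible) : Bornology.IsBounded W.Gam := by
  obtain ⟨a, ha⟩ := W.exists_bound_Gam hP 1 0
  obtain ⟨b, hb⟩ := W.exists_bound_Gam hP (-1) 0
  obtain ⟨c, hc⟩ := W.exists_bound_Gam hP 0 1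
  obtain ⟨d, hd⟩ := W.exists_bound_Gam hP 0 (-1)
  refine (Metric.isBounded_Icc ((-b, -d) : ℝ × ℝ) (a, c)).subset fun θ hθ => ?_
  have h1 := ha θ hθ
  have h2 := hb θ hθ
  have h3 := hc θ hθ
  have h4 := hd θ hθ
  norm_num at h1 h2 h3 h4
  exact ⟨⟨by dsimp only; linarith, by dsimp only; linarith⟩, ⟨h1, h3⟩⟩

theorem isCompact_closure_Gam [Nonempty S₀] (hP : W.P.Irreducible) : IsCompact (closure W.Gam) :=
  (W.isBounded_Gam hP).isCompact_closure

end Finite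

/-! ### Block structure of `P₊` along each coordinate -/

section Slices

theorem tsum_three_succ (k : ℕ) (F : ℕ → ℝ≥0∞)
    (hF : ∀ m, m ≠ k → m ≠ k + 1 → m ≠ k + 2 → F m = 0) :
    ∑' m, F m = F k + F (k + 1) + F (k + 2) := by
  rw [tsum_eq_sum (s := {k, k + 1, k + 2}) fun m hm => by
    simp only [Finset.mem_insert, Finset.mem_singleton, not_or] at hm
    exact hF m hm.1 hm.2.1 hm.2.2]
  rw [Finset.sum_insert (by simp), Finset.sum_insert (by simp), Finset.sum_singleton, add_assoc]

theorem tsum_two (F : ℕ → ℝ≥0∞) (hF : ∀ m, m ≠ 0 → m ≠ 1 → F m = 0) :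
    ∑' m, F m = F 0 + F 1 := by
  rw [tsum_eq_sum (s := {0, 1}) fun m hm => by
    simp only [Finset.mem_insert, Finset.mem_singleton, not_or] at hm
    exact hF m hm.1 hm.2]
  rw [Finset.sum_insert (by simp), Finset.sum_singleton]

theorem vmul_A1_eq_zero {k : ℤ} (hk : k ∉ ({-1, 0, 1} : Set ℤ)) (x : ℕ × S₀ → ℝ≥0∞) (u : ℕ × S₀) :
    vmul x (W.A1 k) u = 0 := by
  simp [vmul, A1, W.A_eq_zero_left hk]

theorem vmul_A2_eq_zero {k : ℤ} (hk : k ∉ ({-1, 0, 1} : Set ℤ)) (x : ℕ × S₀ → ℝ≥0∞) (u : ℕ × S₀) :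
    vmul x (W.A2 k) u = 0 := by
  simp [vmul, A2, W.A_eq_zero_right hk]

theorem vmul_Pplus_eq_tsum_A1 (q : MMRWQuad S₀ → ℝ≥0∞) (k : ℕ) (u : ℕ × S₀) :
    vmul q W.Pplus (k, u) = ∑' m : ℕ, vmul (fun w => q (m, w)) (W.A1 ((k : ℤ) - m)) u := by
  simp only [vmul]
  rw [ENNReal.tsum_prod']
  simp only [A1, ← Pplus_eq_A]

theorem vmul_Pplus_eq_tsum_A2 (q : MMRWQuad S₀ → ℝ≥0∞) (k : ℕ) (u : ℕ × S₀) :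
    vmul q W.Pplus (u.1, k, u.2) =
      ∑' m : ℕ, vmul (fun w => q (w.1, m, w.2)) (W.A2 ((k : ℤ) - m)) u := by
  simp only [vmul, A2]
  rw [ENNReal.tsum_prod']
  simp only [ENNReal.tsum_prod']
  rw [ENNReal.tsum_comm]
  simp only [← Pplus_eq_A]

theorem vmul_Pplus_succ₁ (q : MMRWQuad S₀ → ℝ≥0∞) (k : ℕ) (u : ℕ × S₀) :
    vmul q W.Pplus (k + 1, u) = vmul (fun w => q (k, w)) (W.A1 1) u +
      vmul (fun w => q (k + 1, w)) (W.A1 0) u + vmul (fun w => q (k + 2, w)) (W.A1 (-1)) u := by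
  rw [vmul_Pplus_eq_tsum_A1, tsum_three_succ k _ fun m h1 h2 h3 => W.vmul_A1_eq_zero (by
    simp only [Set.mem_insert_iff, Set.mem_singleton_iff]; push_cast; lia) _ _]
  push_cast
  ring_nf

theorem vmul_Pplus_zero₁ (q : MMRWQuad S₀ → ℝ≥0∞) (u : ℕ × S₀) :
    vmul q W.Pplus (0, u) = vmul (fun w => q (0, w)) (W.A1 0) u +
      vmul (fun w => q (1, w)) (W.A1 (-1)) u := by
  rw [vmul_Pplus_eq_tsum_A1, tsum_two _ fun m h1 h2 => W.vmul_A1_eq_zero (by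
    simp only [Set.mem_insert_iff, Set.mem_singleton_iff]; push_cast; lia) _ _]
  norm_num

theorem vmul_Pplus_succ₂ (q : MMRWQuad S₀ → ℝ≥0∞) (k : ℕ) (u : ℕ × S₀) :
    vmul q W.Pplus (u.1, k + 1, u.2) = vmul (fun w => q (w.1, k, w.2)) (W.A2 1) u +
      vmul (fun w => q (w.1, k + 1, w.2)) (W.A2 0) u +
      vmul (fun w => q (w.1, k + 2, w.2)) (W.A2 (-1)) u := by
  rw [vmul_Pplus_eq_tsum_A2, tsum_three_succ k _ fun m h1 h2 h3 => W.vmul_A2_eq_zero (by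
    simp only [Set.mem_insert_iff, Set.mem_singleton_iff]; push_cast; lia) _ _]
  push_cast
  ring_nf

theorem vmul_Pplus_zero₂ (q : MMRWQuad S₀ → ℝ≥0∞) (u : ℕ × S₀) :
    vmul q W.Pplus (u.1, 0, u.2) = vmul (fun w => q (w.1, 0, w.2)) (W.A2 0) u +
      vmul (fun w => q (w.1, 1, w.2)) (W.A2 (-1)) u := by
  rw [vmul_Pplus_eq_tsum_A2, tsum_two _ fun m h1 h2 => W.vmul_A2_eq_zero (by
    simp only [Set.mem_insert_iff, Set.mem_singleton_iff]; push_cast; lia) _ _]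
  norm_num

end Slices

end MMRW

/-! ### Excessive measures on the quadrant -/

namespace NNMat

variable {ι : Type*} {q : ι → ℝ≥0∞} {M : NNMat ι}

theorem apply_mul_pow_le (h : ∀ j, vmul q M j ≤ q j) (n : ℕ) (i j : ι) :
    q i * pow M n i j ≤ q j := by
  simpa using pow_apply_le (c := 1) (by simpa using h) n i j

/-- Positive mass is carried along positive-probability paths. Infinite values are allowed, so the
lemma also turns a closed proper set of states into a contradiction. -/
theorem Irreducible.excessive_ne_zero (hM : M.Irreducible) (h : ∀ j, vmul q M j ≤ q j) {i : ι}
    (hi : q i ≠ 0) (j : ι) : q j ≠ 0 := by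
  obtain ⟨n, -, hn⟩ := hM i j
  exact ((pos_iff_ne_zero.2 (mul_ne_zero hi hn.ne')).trans_le (apply_mul_pow_le h n i j)).ne'

end NNMat

namespace MMRW

open NNMat

variable {S₀ : Type*} (W : MMRW S₀)

/-- Translation away from the axes keeps every path inside the quadrant and only adds new ones. -/
theorem pow_Pplus_le_translate (d₁ d₂ : ℕ) (n : ℕ) (y y' : MMRWQuad S₀) :
    pow W.Pplus n y y' ≤
      pow W.Pplus n (y.1 + d₁, y.2.1 + d₂, y.2.2) (y'.1 + d₁, y'.2.1 + d₂, y'.2.2) := by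
  classical
  let e : MMRWQuad S₀ → MMRWQuad S₀ := fun y => (y.1 + d₁, y.2.1 + d₂, y.2.2)
  have he : Function.Injective e := by
    rintro ⟨x₁, x₂, i⟩ ⟨y₁, y₂, j⟩ h
    simpa [e] using h
  have hP : ∀ x x' : MMRWQuad S₀, W.Pplus (e x) (e x') = W.Pplus x x' := by
    rintro ⟨x₁, x₂, i⟩ ⟨y₁, y₂, j⟩
    simp only [e, Pplus_eq_A]
    push_cast
    congr 1 <;> ring
  change pow W.Pplus n y y' ≤ pow W.Pplus n (e y) (e y')
  induction n generalizing y' with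
  | zero => by_cases h : y = y' <;> simp [pow, NNMat.id, he.eq_iff, h]
  | succ n ih =>
    calc pow W.Pplus (n + 1) y y' = ∑' x, pow W.Pplus n y x * W.Pplus x y' := rfl
      _ ≤ ∑' x, pow W.Pplus n (e y) (e x) * W.Pplus (e x) (e y') :=
        ENNReal.tsum_le_tsum fun x => by rw [hP]; exact mul_le_mul' (ih x) le_rfl
      _ ≤ ∑' x, pow W.Pplus n (e y) x * W.Pplus x (e y') :=
        ENNReal.tsum_comp_le_tsum_of_injective he
          fun x => pow W.Pplus n (e y) x * W.Pplus x (e y')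

section Excessive

variable {W} {q : MMRWQuad S₀ → ℝ≥0∞}

/-- Harnack inequality: the logarithm of an excessive measure has increments bounded above. -/
theorem exists_log_sub_le (hW : W.Pplus.Irreducible) (hq : ∀ y, vmul q W.Pplus y ≤ q y)
    (h0 : ∀ y, q y ≠ 0) (ht : ∀ y, q y ≠ ∞) (s t s' t' : ℕ) (i j : S₀) :
    ∃ C : ℝ, ∀ x y : ℕ, Real.log (q (x + s, y + t, i)).toReal -
      Real.log (q (x + s', y + t', j)).toReal ≤ C := by
  -- One path, translated by `(x, y)`, serves all base points at once, which makes the constant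
  -- uniform.
  obtain ⟨n, -, hn⟩ := hW (s, t, i) (s', t', j)
  set p := pow W.Pplus n (s, t, i) (s', t', j)
  have hle : ∀ x y : ℕ, q (x + s, y + t, i) * p ≤ q (x + s', y + t', j) := fun x y => by
    have h1 := W.pow_Pplus_le_translate x y n (s, t, i) (s', t', j)
    simp only [add_comm _ x, add_comm _ y] at h1
    exact (mul_le_mul' le_rfl h1).trans (apply_mul_pow_le hq n _ _)
  have hp : p ≠ ∞ := fun hp => by
    have h1 := hle 0 0
    rw [hp, ENNReal.mul_top (h0 _), top_le_iff] at h1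
    exact ht _ h1
  refine ⟨-Real.log p.toReal, fun x y => ?_⟩
  have h1 := ENNReal.toReal_mono (ht _) (hle x y)
  have h2 : 0 < (q (x + s, y + t, i)).toReal := ENNReal.toReal_pos (h0 _) (ht _)
  have h3 : 0 < p.toReal := ENNReal.toReal_pos hn.ne' hp
  rw [ENNReal.toReal_mul] at h1
  have h4 := Real.log_le_log (mul_pos h2 h3) h1
  rw [Real.log_mul h2.ne' h3.ne'] at h4
  linarith

theorem isBdd₂_log_sub (hW : W.Pplus.Irreducible) (hq : ∀ y, vmul q W.Pplus y ≤ q y)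
    (h0 : ∀ y, q y ≠ 0) (ht : ∀ y, q y ≠ ∞) (s t s' t' : ℕ) (i j : S₀) :
    IsBdd₂ fun x y : ℕ => Real.log (q (x + s, y + t, i)).toReal -
      Real.log (q (x + s', y + t', j)).toReal := by
  obtain ⟨C, hC⟩ := exists_log_sub_le hW hq h0 ht s t s' t' i j
  obtain ⟨D, hD⟩ := exists_log_sub_le hW hq h0 ht s' t' s t j i
  refine ⟨max C D, fun x y => abs_le'.2 ⟨(hC x y).trans (le_max_left _ _), ?_⟩⟩
  rw [neg_sub]
  exact (hD x y).trans (le_max_right _ _)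

theorem sum_exp_log_sub_le [Fintype S₀] (hq : ∀ y, vmul q W.Pplus y ≤ q y)
    (h0 : ∀ y, q y ≠ 0) (ht : ∀ y, q y ≠ ∞) (x y : ℕ) (j : S₀) :
    ∑ s : Fin 3, ∑ t : Fin 3, ∑ i, W.Areal (1 - (s : ℕ)) (1 - (t : ℕ)) i j *
      Real.exp (Real.log (q (x + s, y + t, i)).toReal -
        Real.log (q (x + 1, y + 1, j)).toReal) ≤ 1 := by
  let e : Fin 3 × Fin 3 × S₀ → MMRWQuad S₀ := fun p => (x + p.1, y + p.2.1, p.2.2)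
  have he : Function.Injective e := by
    rintro ⟨s, t, i⟩ ⟨s', t', i'⟩ h
    simp only [e, Prod.mk.injEq, add_right_inj] at h
    simpa only [Prod.mk.injEq, Fin.ext_iff] using h
  have hpos : ∀ y, 0 < (q y).toReal := fun y => ENNReal.toReal_pos (h0 y) (ht y)
  have h1 : ∑ p, q (e p) * W.Pplus (e p) (x + 1, y + 1, j) ≤ q (x + 1, y + 1, j) := by
    rw [← tsum_fintype (L := .unconditional _)]
    exact (ENNReal.tsum_comp_le_tsum_of_injective he
      fun z => q z * W.Pplus z (x + 1, y + 1, j)).trans (hq _)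
  have h2 := ENNReal.toReal_mono (ht _) h1
  have hterm : ∀ p : Fin 3 × Fin 3 × S₀, W.Pplus (e p) (x + 1, y + 1, j) =
      W.A (1 - (p.1 : ℕ)) (1 - (p.2.1 : ℕ)) p.2.2 j := fun p => by
    simp only [e, Pplus_eq_A]
    push_cast
    congr 1 <;> ring
  simp only [hterm] at h2
  rw [ENNReal.toReal_sum fun p _ => ENNReal.mul_ne_top (ht _) (W.A_ne_top _ _ _ _),
    Fintype.sum_prod_type] at h2
  simp only [Fintype.sum_prod_type, ENNReal.toReal_mul] at h2
  refine le_of_eq_of_le ?_ ((div_le_one (hpos _)).2 h2)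
  simp only [Finset.sum_div]
  refine Finset.sum_congr rfl fun s _ => Finset.sum_congr rfl fun t _ =>
    Finset.sum_congr rfl fun i _ => ?_
  rw [Real.exp_sub, Real.exp_log (hpos _), Real.exp_log (hpos _)]
  change (W.A _ _ _ _).toReal * _ = _
  rw [mul_comm, div_mul_eq_mul_div]

theorem exists_log_le {f : ℕ → ℝ≥0∞} (h0 : ∀ k, f k ≠ 0) {r : ℝ≥0} (hr : r ≠ 0)
    (hsum : ∑' k, f k * (r : ℝ≥0∞) ^ k < ∞) :
    ∃ M : ℝ, ∀ k : ℕ, Real.log (f k).toReal ≤ M - k * Real.log r := by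
  set T := ∑' k, f k * (r : ℝ≥0∞) ^ k
  refine ⟨Real.log T.toReal, fun k => ?_⟩
  have h1 : f k * (r : ℝ≥0∞) ^ k ≤ T := ENNReal.le_tsum k
  have hr' : ((r : ℝ≥0∞)) ^ k ≠ 0 := pow_ne_zero _ (by exact_mod_cast hr)
  have hf : f k ≠ ∞ := fun hf => by
    rw [hf, ENNReal.top_mul hr'] at h1
    exact hsum.not_ge h1
  have h2 := ENNReal.toReal_mono hsum.ne h1
  have h3 : 0 < (f k).toReal := ENNReal.toReal_pos (h0 k) hf
  have h4 : (0 : ℝ) < r := by exact_mod_cast pos_iff_ne_zero.2 hr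
  rw [ENNReal.toReal_mul, ENNReal.toReal_pow, ENNReal.coe_toReal] at h2
  have h5 := Real.log_le_log (by positivity) h2
  rw [Real.log_mul h3.ne' (by positivity), Real.log_pow] at h5
  linarith

variable [Fintype S₀] [DecidableEq S₀]

/-- The upper bound in general form: convergence at `r` forces `log q ≤ M - k log r` on a line, and
averaging `log q` turns this rate into a coordinate of a point in the closure of `Γ`. -/
theorem exists_mem_closure_Gam_of_excessive₁ (hW : W.Pplus.Irreducible) (hne : W.Gam.Nonempty)
    (hq : ∀ y, vmul q W.Pplus y ≤ q y) {y₀ : MMRWQuad S₀} (h0 : q y₀ ≠ 0) (ht : ∀ y, q y ≠ ∞)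
    (l : ℕ) (j : S₀) {r : ℝ≥0} (hr : r ≠ 0)
    (hsum : ∑' k : ℕ, q (k, l, j) * (r : ℝ≥0∞) ^ k < ∞) :
    ∃ θ ∈ closure W.Gam, Real.log r ≤ θ.1 := by
  replace h0 := hW.excessive_ne_zero hq h0
  obtain ⟨M, hM⟩ := exists_log_le (fun k => h0 (k, l, j)) hr hsum
  obtain ⟨θ, v, hθ, hv, h⟩ := exists_exponential_excessive W.Areal W.Areal_nonneg
    (fun x y i => Real.log (q (x, y, i)).toReal) (isBdd₂_log_sub hW hq h0 ht)
    (sum_exp_log_sub_le hq h0 ht) l j (Real.log r) M hM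
  refine ⟨θ, W.mem_closure_Gam hv (fun j => le_of_eq_of_le ?_ (h j)) hne, hθ⟩
  simp only [Amgf_apply, Finset.mul_sum]
  rw [Finset.sum_comm]
  exact Finset.sum_congr rfl fun s _ => Finset.sum_comm

theorem exists_mem_closure_Gam_of_excessive₂ (hW : W.Pplus.Irreducible) (hne : W.Gam.Nonempty)
    (hq : ∀ y, vmul q W.Pplus y ≤ q y) {y₀ : MMRWQuad S₀} (h0 : q y₀ ≠ 0) (ht : ∀ y, q y ≠ ∞)
    (l : ℕ) (j : S₀) {r : ℝ≥0} (hr : r ≠ 0)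
    (hsum : ∑' k : ℕ, q (l, k, j) * (r : ℝ≥0∞) ^ k < ∞) :
    ∃ θ ∈ closure W.Gam, Real.log r ≤ θ.2 := by
  replace h0 := hW.excessive_ne_zero hq h0
  obtain ⟨M, hM⟩ := exists_log_le (fun k => h0 (l, k, j)) hr hsum
  obtain ⟨θ, v, hθ, hv, h⟩ := exists_exponential_excessive (fun m n => W.Areal n m)
    (fun m n => W.Areal_nonneg n m) (fun x y i => Real.log (q (y, x, i)).toReal)
    (fun s t s' t' i j => by
      obtain ⟨C, hC⟩ := isBdd₂_log_sub hW hq h0 ht t s t' s' i j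
      exact ⟨C, fun x y => hC y x⟩)
    (fun x y j => by
      rw [Finset.sum_comm]
      exact sum_exp_log_sub_le hq h0 ht y x j) l j (Real.log r) M hM
  refine ⟨(θ.2, θ.1), W.mem_closure_Gam hv (fun j => le_of_eq_of_le ?_ (h j)) hne, hθ⟩
  simp only [Amgf_apply, Finset.mul_sum]
  rw [Finset.sum_comm, Finset.sum_congr rfl fun s _ => Finset.sum_comm, Finset.sum_comm]
  simp only [add_comm]

end Excessive

/-! ### The Green function and its exponential decay -/

/-- The Green function `∑ₙ P₊ⁿ`. -/
noncomputable def green (y y' : MMRWQuad S₀) : ℝ≥0∞ := ∑' n, pow W.Pplus n y y'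

/-- Multiplication by `P₊` shifts the series, losing its term `n = 0`. -/
theorem vmul_green_le (y y' : MMRWQuad S₀) : vmul (W.green y) W.Pplus y' ≤ W.green y y' := by
  simp only [vmul, green, ← ENNReal.tsum_mul_right]
  rw [ENNReal.tsum_comm]
  exact ENNReal.tsum_comp_le_tsum_of_injective (add_left_injective 1) fun n => pow W.Pplus n y y'

theorem green_self_ne_zero (y : MMRWQuad S₀) : W.green y y ≠ 0 := by
  classical
  have h : pow W.Pplus 0 y y ≤ W.green y y := ENNReal.le_tsum 0
  simp only [pow, NNMat.id, if_true] at h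
  exact (zero_lt_one.trans_le h).ne'

section Green

variable [Fintype S₀] [DecidableEq S₀]

/-- The weight of `θ` is `ρ`-subinvariant with `ρ < 1`, so the series over `n` is dominated by a
geometric one. -/
theorem exists_green_le {θ : ℝ × ℝ} (hθ : θ ∈ W.Gam) (y : MMRWQuad S₀) :
    ∃ C : S₀ → ℝ≥0∞, (∀ j, C j ≠ ∞) ∧ ∀ (k l : ℕ) (j : S₀),
      W.green y (k, l, j) ≤ C j * ENNReal.ofReal (Real.exp (-(k * θ.1 + l * θ.2))) := by
  obtain ⟨v, ρ, hv, hρ0, hρ1, h⟩ := W.exists_left_of_mem_Gam hθ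
  have hρ : ENNReal.ofReal ρ < 1 := by simpa using hρ1
  set a := expWeight θ v (emb y)
  have ha : a ≠ 0 := expWeight_ne_zero hv _
  have ha' : a ≠ ∞ := expWeight_ne_top _ _ _
  refine ⟨fun j => a⁻¹ * ((1 - ENNReal.ofReal ρ)⁻¹ * ENNReal.ofReal (v j)), fun j =>
    ENNReal.mul_ne_top (ENNReal.inv_ne_top.2 ha) (ENNReal.mul_ne_top
      (ENNReal.inv_ne_top.2 (tsub_pos_of_lt hρ).ne') ENNReal.ofReal_ne_top), fun k l j => ?_⟩
  have h1 : a * W.green y (k, l, j) ≤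
      ∑' n, ENNReal.ofReal ρ ^ n * expWeight θ v (emb (k, l, j)) := by
    rw [green, ← ENNReal.tsum_mul_left]
    exact ENNReal.tsum_le_tsum fun n => pow_apply_le (W.vmul_expWeight_Pplus hv h) n y (k, l, j)
  rw [ENNReal.tsum_mul_right, ENNReal.tsum_geometric] at h1
  have h2 : expWeight θ v (emb (k, l, j)) =
      ENNReal.ofReal (v j) * ENNReal.ofReal (Real.exp (-(k * θ.1 + l * θ.2))) := by
    rw [← ENNReal.ofReal_mul (hv j).le, mul_comm]
    simp [expWeight, emb]
  rw [h2] at h1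
  calc W.green y (k, l, j) = a⁻¹ * (a * W.green y (k, l, j)) := by
        rw [← mul_assoc, ENNReal.inv_mul_cancel ha ha', one_mul]
    _ ≤ _ := mul_le_mul' le_rfl h1
    _ = _ := by ring

theorem green_ne_top (hne : W.Gam.Nonempty) (y y' : MMRWQuad S₀) : W.green y y' ≠ ∞ := by
  obtain ⟨θ, hθ⟩ := hne
  obtain ⟨C, hC, h⟩ := W.exists_green_le hθ y
  exact ne_top_of_le_ne_top (ENNReal.mul_ne_top (hC _) ENNReal.ofReal_ne_top) (h y'.1 y'.2.1 y'.2.2)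

theorem tsum_lt_top_of_le_geometric {f : ℕ → ℝ≥0∞} {C : ℝ≥0∞} (hC : C ≠ ∞) {τ : ℝ}
    (hf : ∀ k : ℕ, f k ≤ C * ENNReal.ofReal (Real.exp (-(k * τ)))) {r : ℝ≥0}
    (hr : (r : ℝ≥0∞) < ENNReal.ofReal (Real.exp τ)) : ∑' k, f k * (r : ℝ≥0∞) ^ k < ∞ := by
  have h1 : (r : ℝ≥0∞) * ENNReal.ofReal (Real.exp (-τ)) < 1 := by
    rw [ENNReal.coe_nnreal_eq] at hr ⊢
    rw [ENNReal.ofReal_lt_ofReal_iff (Real.exp_pos _)] at hr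
    rw [← ENNReal.ofReal_mul r.coe_nonneg, ENNReal.ofReal_lt_one, Real.exp_neg, ← div_eq_mul_inv,
      div_lt_one (Real.exp_pos _)]
    exact hr
  have h2 : ∀ k : ℕ, f k * (r : ℝ≥0∞) ^ k ≤ C * (r * ENNReal.ofReal (Real.exp (-τ))) ^ k := by
    intro k
    rw [mul_pow, ← ENNReal.ofReal_pow (Real.exp_pos _).le, ← Real.exp_nat_mul,
      mul_comm ((r : ℝ≥0∞) ^ k), ← mul_assoc, mul_neg]
    exact mul_le_mul' (hf k) le_rfl
  refine (ENNReal.tsum_le_tsum h2).trans_lt ?_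
  rw [ENNReal.tsum_mul_left, ENNReal.tsum_geometric]
  exact ENNReal.mul_lt_top hC.lt_top (ENNReal.inv_lt_top.2 (tsub_pos_of_lt h1))

theorem tsum_green_lt_top₁ {θ : ℝ × ℝ} (hθ : θ ∈ W.Gam) (y : MMRWQuad S₀) (l : ℕ) (j : S₀)
    {r : ℝ≥0} (hr : (r : ℝ≥0∞) < ENNReal.ofReal (Real.exp θ.1)) :
    ∑' k : ℕ, W.green y (k, l, j) * (r : ℝ≥0∞) ^ k < ∞ := by
  obtain ⟨C, hC, h⟩ := W.exists_green_le hθ y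
  refine tsum_lt_top_of_le_geometric (C := C j * ENNReal.ofReal (Real.exp (-(l * θ.2))))
    (ENNReal.mul_ne_top (hC j) ENNReal.ofReal_ne_top) (fun k => (h k l j).trans_eq ?_) hr
  rw [mul_assoc, ← ENNReal.ofReal_mul (Real.exp_pos _).le, ← Real.exp_add]
  congr 3
  ring

theorem tsum_green_lt_top₂ {θ : ℝ × ℝ} (hθ : θ ∈ W.Gam) (y : MMRWQuad S₀) (l : ℕ) (j : S₀)
    {r : ℝ≥0} (hr : (r : ℝ≥0∞) < ENNReal.ofReal (Real.exp θ.2)) :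
    ∑' k : ℕ, W.green y (l, k, j) * (r : ℝ≥0∞) ^ k < ∞ := by
  obtain ⟨C, hC, h⟩ := W.exists_green_le hθ y
  refine tsum_lt_top_of_le_geometric (C := C j * ENNReal.ofReal (Real.exp (-(l * θ.1))))
    (ENNReal.mul_ne_top (hC j) ENNReal.ofReal_ne_top) (fun k => (h l k j).trans_eq ?_) hr
  rw [mul_assoc, ← ENNReal.ofReal_mul (Real.exp_pos _).le, ← Real.exp_add]
  congr 3
  ring

end Green

end MMRW

/-! ### The convergence parameter of the rate matrices -/

namespace MMRW

open NNMat

variable {S₀ : Type*} {W : MMRW S₀}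

theorem exists_A1_ne_zero (hW : W.Pplus.Irreducible) [Nonempty S₀] :
    ∃ u₀ u, W.A1 1 u₀ u ≠ 0 := by
  classical
  by_contra! h
  obtain ⟨j⟩ := ‹Nonempty S₀›
  -- Without upward steps in the first coordinate the level `0` feeds no other level, so this
  -- measure is excessive (with `0 * ∞ = 0`), yet it vanishes somewhere.
  let q : MMRWQuad S₀ → ℝ≥0∞ := fun y => if y.1 = 0 then ∞ else 0
  refine hW.excessive_ne_zero (q := q) (i := (0, 0, j)) ?_ (by simp [q]) (1, 0, j) (by simp [q])
  rintro ⟨k, u⟩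
  rcases k with _ | k
  · simp [q]
  · refine le_of_eq_of_le ?_ bot_le
    rw [W.vmul_Pplus_succ₁]
    have h1 : ∀ m, vmul (fun w => q (m + 1, w)) = 0 := fun m => by
      funext M j; simp [vmul, q]
    rw [h1, show k + 2 = k + 1 + 1 from rfl, h1]
    simp [vmul, h]

theorem exists_A2_ne_zero (hW : W.Pplus.Irreducible) [Nonempty S₀] :
    ∃ u₀ u, W.A2 1 u₀ u ≠ 0 := by
  classical
  by_contra! h
  obtain ⟨j⟩ := ‹Nonempty S₀›
  let q : MMRWQuad S₀ → ℝ≥0∞ := fun y => if y.2.1 = 0 then ∞ else 0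
  refine hW.excessive_ne_zero (q := q) (i := (0, 0, j)) ?_ (by simp [q]) (0, 1, j) (by simp [q])
  rintro ⟨l, k, j⟩
  rcases k with _ | k
  · simp [q]
  · refine le_of_eq_of_le ?_ bot_le
    rw [W.vmul_Pplus_succ₂ _ k (l, j)]
    have h1 : ∀ m, vmul (fun w : ℕ × S₀ => q (w.1, m + 1, w.2)) = 0 := fun m => by
      funext M j; simp [vmul, q]
    rw [h1, show k + 2 = k + 1 + 1 from rfl, h1]
    simp [vmul, h]

section Excessive

variable {R : NNMat (ℕ × S₀)}

/-- Level `k` carries the power `k + 1`: the three-term recursion of the powers gives equality above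
the boundary, and at level `0` the omitted term `R ^ 0 * B₁` is the slack. -/
theorem excessive_pow_rate₁ (hR : IsRateMatrix (W.A1 (-1)) (W.A1 0) (W.A1 1) R) (u₀ : ℕ × S₀)
    (y : MMRWQuad S₀) :
    vmul (fun y : MMRWQuad S₀ => pow R (y.1 + 1) u₀ y.2) W.Pplus y ≤ pow R (y.1 + 1) u₀ y.2 := by
  obtain ⟨k, u⟩ := y
  have h := fun k => congrFun (congrFun (hR.pow_eq k) u₀) u
  simp only [Pi.add_apply, mul_apply_eq_vmul] at h
  rcases k with _ | k
  · rw [vmul_Pplus_zero₁]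
    rw [h 0, add_comm (vmul _ _ _)]
    exact le_self_add
  · rw [vmul_Pplus_succ₁]
    dsimp only
    rw [h (k + 1)]
    exact le_of_eq (by abel)

theorem excessive_pow_rate₂ (hR : IsRateMatrix (W.A2 (-1)) (W.A2 0) (W.A2 1) R) (u₀ : ℕ × S₀)
    (y : MMRWQuad S₀) :
    vmul (fun y : MMRWQuad S₀ => pow R (y.2.1 + 1) u₀ (y.1, y.2.2)) W.Pplus y ≤
      pow R (y.2.1 + 1) u₀ (y.1, y.2.2) := by
  obtain ⟨l, k, j⟩ := y
  have h := fun k => congrFun (congrFun (hR.pow_eq k) u₀) (l, j)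
  simp only [Pi.add_apply, mul_apply_eq_vmul] at h
  rcases k with _ | k
  · rw [W.vmul_Pplus_zero₂ _ (l, j)]
    rw [h 0, add_comm (vmul _ _ _)]
    exact le_self_add
  · rw [W.vmul_Pplus_succ₂ _ k (l, j), h (k + 1)]
    exact le_of_eq (by abel)

theorem tsum_shift_lt_top {f : ℕ → ℝ≥0∞} {r : ℝ≥0} (hr : r ≠ 0)
    (h : ∑' n, (r : ℝ≥0∞) ^ n * f n < ∞) : ∑' k, f (k + 1) * (r : ℝ≥0∞) ^ k < ∞ := by
  have h1 : (r : ℝ≥0∞) * ∑' k, f (k + 1) * (r : ℝ≥0∞) ^ k < ∞ := by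
    refine lt_of_le_of_lt ?_ h
    rw [← ENNReal.tsum_mul_left]
    refine (ENNReal.tsum_le_tsum fun k => le_of_eq ?_).trans
      (ENNReal.tsum_comp_le_tsum_of_injective (add_left_injective 1)
        fun n => (r : ℝ≥0∞) ^ n * f n)
    ring
  by_contra h2
  rw [not_lt, top_le_iff] at h2
  rw [h2, ENNReal.mul_top (by exact_mod_cast hr)] at h1
  exact lt_irrefl _ h1

theorem apply_ne_top_of_tsum {f : ℕ → ℝ≥0∞} {r : ℝ≥0} (hr : r ≠ 0)
    (h : ∑' n, (r : ℝ≥0∞) ^ n * f n < ∞) (n : ℕ) : f n ≠ ∞ := fun hf => by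
  have h1 := (ENNReal.le_tsum (f := fun n => (r : ℝ≥0∞) ^ n * f n) n).trans_lt h
  rw [hf, ENNReal.mul_top (pow_ne_zero _ (by exact_mod_cast hr))] at h1
  exact lt_irrefl _ h1

theorem IsRateMatrix.Bpos_le {ι : Type*} {Bneg Bzero Bpos R : NNMat ι}
    (hR : IsRateMatrix Bneg Bzero Bpos R) (i j : ι) : Bpos i j ≤ R i j := by
  conv_rhs => rw [hR.1.2]
  exact le_add_self

variable [Fintype S₀] [DecidableEq S₀] [Nonempty S₀]

theorem exists_mem_closure_Gam_of_rate₁ (hW : W.Pplus.Irreducible) (hne : W.Gam.Nonempty)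
    (hR : IsRateMatrix (W.A1 (-1)) (W.A1 0) (W.A1 1) R) {r : ℝ≥0} (hr : r ≠ 0)
    (hsum : ∀ i j, ∑' n, (r : ℝ≥0∞) ^ n * pow R n i j < ∞) :
    ∃ θ ∈ closure W.Gam, Real.log r ≤ θ.1 := by
  obtain ⟨u₀, u, hu⟩ := exists_A1_ne_zero hW
  refine exists_mem_closure_Gam_of_excessive₁ hW hne (excessive_pow_rate₁ hR u₀)
    (y₀ := (0, u)) ?_ (fun y => apply_ne_top_of_tsum hr (hsum u₀ y.2) _) u.1 u.2 hr
    (tsum_shift_lt_top hr (hsum u₀ u))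
  rw [zero_add, pow_one]
  exact ((pos_iff_ne_zero.2 hu).trans_le (IsRateMatrix.Bpos_le hR _ _)).ne'

theorem exists_mem_closure_Gam_of_rate₂ (hW : W.Pplus.Irreducible) (hne : W.Gam.Nonempty)
    (hR : IsRateMatrix (W.A2 (-1)) (W.A2 0) (W.A2 1) R) {r : ℝ≥0} (hr : r ≠ 0)
    (hsum : ∀ i j, ∑' n, (r : ℝ≥0∞) ^ n * pow R n i j < ∞) :
    ∃ θ ∈ closure W.Gam, Real.log r ≤ θ.2 := by
  obtain ⟨u₀, u, hu⟩ := exists_A2_ne_zero hW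
  refine exists_mem_closure_Gam_of_excessive₂ hW hne (excessive_pow_rate₂ hR u₀)
    (y₀ := (u.1, 0, u.2)) ?_ (fun y => apply_ne_top_of_tsum hr (hsum u₀ (y.1, y.2.2)) _) u.1 u.2 hr
    (tsum_shift_lt_top hr (hsum u₀ u))
  rw [zero_add, pow_one]
  exact ((pos_iff_ne_zero.2 hu).trans_le (IsRateMatrix.Bpos_le hR _ _)).ne'

end Excessive

section Subinvariant

variable [Fintype S₀]

/-- The slices of the exponential weight are `c ^ k * x`, so the claim is its subinvariance at level
`1`, the lowest level with neighbours on both sides. -/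
theorem rate_hypothesis₁ {θ : ℝ × ℝ} {v : S₀ → ℝ} (hv : ∀ i, 0 < v i)
    (h : ∀ j, ∑ i, v i * W.Amgf θ i j ≤ v j) (u : ℕ × S₀) :
    let c := ENNReal.ofReal (Real.exp (-θ.1))
    let x : ℕ × S₀ → ℝ≥0∞ := fun u => expWeight θ v (emb (0, u))
    c * c * vmul x (W.A1 (-1)) u + c * vmul x (W.A1 0) u + vmul x (W.A1 1) u ≤ c * x u := by
  intro c x
  have hc : ∀ (k : ℕ) (w : ℕ × S₀), expWeight θ v (emb (k, w)) = c ^ k * x w := fun k w => by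
    simp only [c, x, expWeight, emb]
    rw [← ENNReal.ofReal_pow (Real.exp_pos _).le, ← Real.exp_nat_mul,
      ← ENNReal.ofReal_mul (Real.exp_pos _).le, ← mul_assoc, ← Real.exp_add]
    congr 3
    push_cast
    ring
  have h1 := W.vmul_expWeight_Pplus hv (ρ := 1) (by simpa using h) (1, u)
  rw [show (1 : ℕ) = 0 + 1 from rfl, vmul_Pplus_succ₁] at h1
  simp only [hc, vmul_smul, ENNReal.ofReal_one, one_mul, zero_add, pow_zero, _root_.pow_one,
    pow_two] at h1
  refine le_of_eq_of_le ?_ h1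
  abel

theorem rate_hypothesis₂ {θ : ℝ × ℝ} {v : S₀ → ℝ} (hv : ∀ i, 0 < v i)
    (h : ∀ j, ∑ i, v i * W.Amgf θ i j ≤ v j) (u : ℕ × S₀) :
    let c := ENNReal.ofReal (Real.exp (-θ.2))
    let x : ℕ × S₀ → ℝ≥0∞ := fun u => expWeight θ v (emb (u.1, 0, u.2))
    c * c * vmul x (W.A2 (-1)) u + c * vmul x (W.A2 0) u + vmul x (W.A2 1) u ≤ c * x u := by
  intro c x
  have hc : ∀ (k : ℕ) (w : ℕ × S₀),
      expWeight θ v (emb (w.1, k, w.2)) = c ^ k * x w := fun k w => by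
    simp only [c, x, expWeight, emb]
    rw [← ENNReal.ofReal_pow (Real.exp_pos _).le, ← Real.exp_nat_mul,
      ← ENNReal.ofReal_mul (Real.exp_pos _).le, ← mul_assoc, ← Real.exp_add]
    congr 3
    push_cast
    ring
  have h1 := W.vmul_expWeight_Pplus hv (ρ := 1) (by simpa using h) (u.1, 1, u.2)
  rw [show (1 : ℕ) = 0 + 1 from rfl, vmul_Pplus_succ₂] at h1
  simp only [hc _ (_, _), vmul_smul, ENNReal.ofReal_one, one_mul, zero_add, pow_zero,
    _root_.pow_one, pow_two] at h1
  refine le_of_eq_of_le ?_ h1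
  abel

variable [DecidableEq S₀]

theorem exists_left_of_mem_Gam' {θ : ℝ × ℝ} (hθ : θ ∈ W.Gam) :
    ∃ v : S₀ → ℝ, (∀ i, 0 < v i) ∧ ∀ j, ∑ i, v i * W.Amgf θ i j ≤ v j := by
  obtain ⟨v, ρ, hv, -, hρ1, h⟩ := W.exists_left_of_mem_Gam hθ
  exact ⟨v, hv, fun j => (h j).trans (mul_le_of_le_one_left (hv j).le hρ1.le)⟩

theorem isRateMatrix_A1 (hne : W.Gam.Nonempty) :
    IsRateMatrix (W.A1 (-1)) (W.A1 0) (W.A1 1) (rate (W.A1 (-1)) (W.A1 0) (W.A1 1)) := by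
  obtain ⟨θ, hθ⟩ := hne
  obtain ⟨v, hv, h⟩ := exists_left_of_mem_Gam' hθ
  exact isRateMatrix_rate ENNReal.ofReal_ne_top (fun _ => expWeight_ne_zero hv _)
    (fun _ => expWeight_ne_top _ _ _) (rate_hypothesis₁ hv h)

theorem isRateMatrix_A2 (hne : W.Gam.Nonempty) :
    IsRateMatrix (W.A2 (-1)) (W.A2 0) (W.A2 1) (rate (W.A2 (-1)) (W.A2 0) (W.A2 1)) := by
  obtain ⟨θ, hθ⟩ := hne
  obtain ⟨v, hv, h⟩ := exists_left_of_mem_Gam' hθ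
  exact isRateMatrix_rate ENNReal.ofReal_ne_top (fun _ => expWeight_ne_zero hv _)
    (fun _ => expWeight_ne_top _ _ _) (rate_hypothesis₂ hv h)

theorem inv_ofReal_exp_neg (t : ℝ) :
    (ENNReal.ofReal (Real.exp (-t)))⁻¹ = ENNReal.ofReal (Real.exp t) := by
  rw [← ENNReal.ofReal_inv_of_pos (Real.exp_pos _), ← Real.exp_neg, neg_neg]

theorem exp_le_cp_rate₁ {θ : ℝ × ℝ} (hθ : θ ∈ W.Gam) :
    ENNReal.ofReal (Real.exp θ.1) ≤ cp (rate (W.A1 (-1)) (W.A1 0) (W.A1 1)) := by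
  obtain ⟨v, hv, h⟩ := exists_left_of_mem_Gam' hθ
  rw [← inv_ofReal_exp_neg]
  exact le_cp (vmul_rate_le (rate_hypothesis₁ hv h)) (fun _ => expWeight_ne_zero hv _)
    (fun _ => expWeight_ne_top _ _ _)

theorem exp_le_cp_rate₂ {θ : ℝ × ℝ} (hθ : θ ∈ W.Gam) :
    ENNReal.ofReal (Real.exp θ.2) ≤ cp (rate (W.A2 (-1)) (W.A2 0) (W.A2 1)) := by
  obtain ⟨v, hv, h⟩ := exists_left_of_mem_Gam' hθ
  rw [← inv_ofReal_exp_neg]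
  exact le_cp (vmul_rate_le (rate_hypothesis₂ hv h)) (fun _ => expWeight_ne_zero hv _)
    (fun _ => expWeight_ne_top _ _ _)

end Subinvariant

end MMRW

/-! ### The occupation measure as a Green function -/

open MeasureTheory in
theorem MeasureTheory.measure_eq_tsum_inter_fiber {Ω T : Type*} [MeasurableSpace Ω] [Countable T]
    (μ : Measure Ω) {F : Ω → T} (hF : ∀ t, MeasurableSet {ω | F ω = t}) {A : Set Ω}
    (hA : MeasurableSet A) : μ A = ∑' t, μ (A ∩ {ω | F ω = t}) := by
  rw [← measure_iUnion _ fun t => hA.inter (hF t)]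
  · congr 1
    ext ω
    simp
  · intro s t hst
    refine Set.disjoint_left.2 fun ω h1 h2 => hst ?_
    exact h1.2.symm.trans h2.2

namespace MMRW

open NNMat MeasureTheory

variable {S₀ : Type*} {W : MMRW S₀} {Ω : Type*}

/-- The event that the process stays in the quadrant up to time `n` and is at `w` at time `n`. -/
def survivalEvent (Y : ℕ → Ω → MMRWState S₀) (n : ℕ) (w : MMRWState S₀) : Set Ω :=
  {ω | (∀ i ≤ n, Y i ω ∈ quadrant S₀) ∧ Y n ω = w}

theorem lt_exitTime_iff (Y : ℕ → Ω → MMRWState S₀) (n : ℕ) (ω : Ω) :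
    (n : WithTop ℕ) < exitTime Y ω ↔ ∀ i ≤ n, Y i ω ∈ quadrant S₀ := by
  constructor
  · intro h i hi
    have h1 : (i : WithTop ℕ) < exitTime Y ω := lt_of_le_of_lt (by exact_mod_cast hi) h
    exact not_not.1 (notMem_of_lt_hittingAfter h1 (Nat.zero_le i))
  · intro h
    simp only [exitTime, hittingAfter]
    split_ifs with h1
    · refine WithTop.coe_lt_coe.2 (not_le.1 fun h2 => ?_)
      exact (Nat.sInf_mem (s := {i | 0 ≤ i ∧ Y i ω ∈ (quadrant S₀)ᶜ}) h1).2 (h _ h2)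
    · exact WithTop.coe_lt_top n

variable [MeasurableSpace Ω] {μ : Measure Ω} {Y : ℕ → Ω → MMRWState S₀} {y₀ : MMRWState S₀}

variable [Countable S₀]

theorem IsChain.measurableSet_mem (hY : W.IsChain μ Y y₀) (n : ℕ) (B : Set (MMRWState S₀)) :
    MeasurableSet {ω | Y n ω ∈ B} := by
  have : {ω | Y n ω ∈ B} = ⋃ z ∈ B, {ω | Y n ω = z} := by ext ω; simp
  rw [this]
  exact MeasurableSet.biUnion B.to_countable fun z _ => hY.measurable n z

theorem IsChain.measurableSet_survivalEvent (hY : W.IsChain μ Y y₀) (n : ℕ) (w : MMRWState S₀) :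
    MeasurableSet (survivalEvent Y n w) := by
  have : survivalEvent Y n w = (⋂ i ≤ n, {ω | Y i ω ∈ quadrant S₀}) ∩ {ω | Y n ω = w} := by
    ext ω; simp [survivalEvent]
  rw [this]
  exact (MeasurableSet.iInter fun i => MeasurableSet.iInter fun _ =>
    hY.measurableSet_mem i _).inter (hY.measurable n w)

theorem IsChain.measure_survivalEvent_succ (hY : W.IsChain μ Y y₀) (n : ℕ) {w' : MMRWState S₀}
    (hw' : w' ∈ quadrant S₀) :
    μ (survivalEvent Y (n + 1) w') = ∑' w, μ (survivalEvent Y n w) * W.P w w' := by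
  -- The Markov hypothesis speaks of whole trajectories, so both sides are split over the countably
  -- many histories up to time `n`.
  let F : Ω → (Fin (n + 1) → MMRWState S₀) := fun ω i => Y i ω
  have hF : ∀ f, MeasurableSet {ω | F ω = f} := fun f => by
    have : {ω | F ω = f} = ⋂ i : Fin (n + 1), {ω | Y i ω = f i} := by
      ext ω; simp [F, funext_iff]
    rw [this]
    exact MeasurableSet.iInter fun i => hY.measurable i _
  rw [measure_eq_tsum_inter_fiber μ hF (hY.measurableSet_survivalEvent _ _)]
  simp only [fun w => measure_eq_tsum_inter_fiber μ hF (hY.measurableSet_survivalEvent n w),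
    ← ENNReal.tsum_mul_right]
  rw [ENNReal.tsum_comm]
  congr 1
  funext f
  by_cases hf : ∀ i, f i ∈ quadrant S₀
  · let z : ℕ → MMRWState S₀ := fun i => if h : i < n + 1 then f ⟨i, h⟩ else w'
    have hz : ∀ i (h : i < n + 1), z i = f ⟨i, h⟩ := fun i h => dif_pos h
    have hz' : z (n + 1) = w' := dif_neg (lt_irrefl _)
    have hset : ∀ ω, F ω = f ↔ ∀ i ≤ n, Y i ω = z i := fun ω => by
      rw [funext_iff]
      constructor
      · intro h i hi
        rw [hz i (Nat.lt_succ_of_le hi)]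
        exact h ⟨i, Nat.lt_succ_of_le hi⟩
      · intro h i
        exact (h i (Nat.le_of_lt_succ i.2)).trans (hz i i.2)
    have hmem : ∀ ω, F ω = f → ∀ i ≤ n, Y i ω ∈ quadrant S₀ := fun ω h i hi => by
      rw [(hset ω).1 h i hi, hz i (Nat.lt_succ_of_le hi)]
      exact hf _
    have h1 : survivalEvent Y (n + 1) w' ∩ {ω | F ω = f} = {ω | ∀ i ≤ n + 1, Y i ω = z i} := by
      ext ω
      simp only [survivalEvent, Set.mem_inter_iff, Set.mem_ofPred_eq]
      constructor
      · rintro ⟨⟨-, h⟩, h'⟩ i hi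
        rcases Nat.le_succ_iff.1 hi with hi | rfl
        · exact (hset ω).1 h' i hi
        · rw [hz', h]
      · intro h
        have h' : F ω = f := (hset ω).2 fun i hi => h i (hi.trans n.le_succ)
        have h'' : Y (n + 1) ω = w' := (h _ le_rfl).trans hz'
        refine ⟨⟨fun i hi => ?_, h''⟩, h'⟩
        rcases Nat.le_succ_iff.1 hi with hi | rfl
        · exact hmem ω h' i hi
        · rw [h'']; exact hw'
    have h2 : survivalEvent Y n (z n) ∩ {ω | F ω = f} = {ω | ∀ i ≤ n, Y i ω = z i} := by
      ext ω
      simp only [survivalEvent, Set.mem_inter_iff, Set.mem_ofPred_eq, hset]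
      exact ⟨fun h => h.2, fun h => ⟨⟨hmem ω ((hset ω).2 h), h n le_rfl⟩, h⟩⟩
    rw [tsum_eq_single (z n), h1, h2, hY.markov n z, hz']
    intro w hw
    have h3 : survivalEvent Y n w ∩ {ω | F ω = f} = ∅ := by
      refine Set.eq_empty_of_forall_notMem fun ω h => hw ?_
      exact h.1.2.symm.trans ((hset ω).1 h.2 n le_rfl)
    rw [h3, measure_empty, zero_mul]
  · push Not at hf
    obtain ⟨i, hi⟩ := hf
    have h0 : ∀ m, n ≤ m → ∀ w, survivalEvent Y m w ∩ {ω | F ω = f} = ∅ := fun m hm w => by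
      refine Set.eq_empty_of_forall_notMem fun ω h => hi ?_
      rw [← show F ω = f from h.2]
      exact h.1.1 i ((Nat.le_of_lt_succ i.2).trans hm)
    simp [h0 n le_rfl, h0 (n + 1) n.le_succ]

theorem IsChain.measure_survivalEvent {y : MMRWQuad S₀} (hY : W.IsChain μ Y (emb y)) (n : ℕ)
    (y' : MMRWQuad S₀) : μ (survivalEvent Y n (emb y')) = pow W.Pplus n y y' := by
  classical
  have hQ : ∀ y : MMRWQuad S₀, emb y ∈ quadrant S₀ := fun y => ⟨by simp [emb], by simp [emb]⟩
  induction n generalizing y' with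
  | zero =>
    have h0 : survivalEvent Y 0 (emb y') = {ω | Y 0 ω = emb y'} := by
      ext ω
      simp only [survivalEvent, Set.mem_ofPred_eq, Nat.le_zero, forall_eq]
      exact ⟨fun h => h.2, fun h => ⟨h ▸ hQ y', h⟩⟩
    rw [h0]
    rcases eq_or_ne y y' with rfl | hne
    · simp [hY.start, pow, NNMat.id]
    · have := hY.isProbability
      have h1 : μ {ω | Y 0 ω = emb y}ᶜ = 0 :=
        (prob_compl_eq_zero_iff (hY.measurable 0 _)).2 hY.start
      have h2 : μ {ω | Y 0 ω = emb y'} = 0 := by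
        refine measure_mono_null (t := {ω | Y 0 ω = emb y}ᶜ) ?_ h1
        exact fun ω (h : Y 0 ω = emb y') (h' : Y 0 ω = emb y) =>
          hne (emb_injective (h'.symm.trans h))
      simp [h2, pow, NNMat.id, hne]
  | succ n ih =>
    rw [hY.measure_survivalEvent_succ n (hQ y')]
    rw [← emb_injective.tsum_eq (f := fun w => μ (survivalEvent Y n w) * W.P w (emb y'))]
    · simp only [ih]
      rfl
    -- Survival up to time `n` forces the state at time `n` into the quadrant, so no mass lies
    -- outside the range of `emb`.
    · rintro ⟨x₁, x₂, j⟩ hw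
      have h1 : μ (survivalEvent Y n (x₁, x₂, j)) ≠ 0 := left_ne_zero_of_mul hw
      obtain ⟨ω, hω, hω'⟩ := nonempty_of_measure_ne_zero h1
      have h2 := hω n le_rfl
      rw [hω'] at h2
      obtain ⟨h3, h4⟩ := h2
      refine ⟨(x₁.toNat, x₂.toNat, j), ?_⟩
      simp only [emb, Prod.mk.injEq, and_true]
      exact ⟨Int.toNat_of_nonneg h3, Int.toNat_of_nonneg h4⟩

/-- The occupation measure is the Green function of the truncated transition matrix. -/
theorem occ_eq_green {ℙ : MMRWState S₀ → Measure Ω} (hY : ∀ y, W.IsChain (ℙ y) Y y)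
    (y y' : MMRWQuad S₀) : occ ℙ Y y y' = W.green y y' := by
  have h1 : ∀ ω n, Set.indicator {n : ℕ | (n : WithTop ℕ) < exitTime Y ω ∧ Y n ω = emb y'}
      (fun _ => (1 : ℝ≥0∞)) n = (survivalEvent Y n (emb y')).indicator 1 ω := fun ω n => by
    have h2 : n ∈ {n : ℕ | (n : WithTop ℕ) < exitTime Y ω ∧ Y n ω = emb y'} ↔
        ω ∈ survivalEvent Y n (emb y') := and_congr (lt_exitTime_iff Y n ω) Iff.rfl
    by_cases h : ω ∈ survivalEvent Y n (emb y')
    · rw [Set.indicator_of_mem h, Set.indicator_of_mem (h2.2 h), Pi.one_apply]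
    · rw [Set.indicator_of_notMem h, Set.indicator_of_notMem (mt h2.1 h)]
  have hm := fun n => (hY (emb y)).measurableSet_survivalEvent n (emb y')
  simp only [occ, h1, green]
  rw [lintegral_tsum fun n => (measurable_one.indicator (hm n)).aemeasurable]
  congr 1
  funext n
  rw [lintegral_indicator_one (hm n), (hY (emb y)).measure_survivalEvent]

end MMRW

/-! ### Negative drift makes `Γ` nonempty -/

section Poisson

variable {S : Type*} [Fintype S]

/-- Solvability of the Poisson equation: if the only harmonic functions of the stochastic matrix
`B` are the constants, then every `f` of zero mean under a stationary distribution is of the form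
`g - B g`. -/
theorem exists_poisson {B : Matrix S S ℝ} {π : S → ℝ} (hπ : π ≠ 0) (hπB : Matrix.vecMul π B = π)
    (hconst : ∀ g : S → ℝ, B.mulVec g = g → ∃ c, g = fun _ => c) {f : S → ℝ}
    (hf : π ⬝ᵥ f = 0) : ∃ g : S → ℝ, g - B.mulVec g = f := by
  let T : (S → ℝ) →ₗ[ℝ] (S → ℝ) := LinearMap.id - B.mulVecLin
  have hT : ∀ g, T g = g - B.mulVec g := fun g => rfl
  let φ : (S → ℝ) →ₗ[ℝ] ℝ := dotProductBilin ℝ ℝ π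
  have hφ : ∀ g, φ g = π ⬝ᵥ g := fun g => rfl
  have hφ0 : φ ≠ 0 := fun h => hπ (dotProduct_eq_zero_iff.1 fun w => by
    rw [← hφ, h]; rfl)
  have hrange : LinearMap.range T ≤ LinearMap.ker φ := by
    rintro _ ⟨g, rfl⟩
    rw [LinearMap.mem_ker, hφ, hT, dotProduct_sub, Matrix.dotProduct_mulVec, hπB, sub_self]
  have hker : Module.finrank ℝ (LinearMap.ker T) ≤ 1 := by
    have h1 : LinearMap.ker T ≤ Submodule.span ℝ {(1 : S → ℝ)} := fun g hg => by
      rw [LinearMap.mem_ker, hT, sub_eq_zero] at hg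
      obtain ⟨c, rfl⟩ := hconst g hg.symm
      exact Submodule.mem_span_singleton.2 ⟨c, by funext; simp⟩
    exact (Submodule.finrank_mono h1).trans ((finrank_span_le_card _).trans (by simp))
  have h1 := LinearMap.finrank_range_add_finrank_ker T
  have h2 := Module.Dual.finrank_ker_add_one_of_ne_zero (f := φ) hφ0
  -- The kernel of `1 - B` has dimension at most one, so the range is at least as large as the
  -- hyperplane `ker φ` that contains it.
  have heq := Submodule.eq_of_le_of_finrank_le hrange (by lia)
  have hmem : f ∈ LinearMap.range T := by
    rw [heq, LinearMap.mem_ker, hφ, hf]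
  exact hmem

end Poisson

namespace MMRW

open NNMat

variable {S₀ : Type*} (W : MMRW S₀)

theorem A_eq_zero_of_Amgf_eq_zero {i j : S₀} (h : W.Amgf (0, 0) i j = 0) (k l : ℤ) :
    W.A k l i j = 0 := by
  by_cases hk : k ∈ ({-1, 0, 1} : Set ℤ)
  swap
  · exact W.A_eq_zero_left hk l i j
  by_cases hl : l ∈ ({-1, 0, 1} : Set ℤ)
  swap
  · exact W.A_eq_zero_right hl k i j
  obtain ⟨s, rfl⟩ := mem_offsets hk
  obtain ⟨t, rfl⟩ := mem_offsets hl
  simp only [Amgf_apply, mul_zero, add_zero, Real.exp_zero, one_mul] at h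
  rw [Finset.sum_eq_zero_iff_of_nonneg fun s _ => Finset.sum_nonneg fun t _ =>
    W.Areal_nonneg _ _ _ _] at h
  have h1 := h s (Finset.mem_univ s)
  rw [Finset.sum_eq_zero_iff_of_nonneg fun t _ => W.Areal_nonneg _ _ _ _] at h1
  have h2 : (W.A _ _ i j).toReal = 0 := h1 t (Finset.mem_univ t)
  exact (ENNReal.toReal_eq_zero_iff _).1 h2 |>.resolve_right (W.A_ne_top _ _ _ _)

variable [Fintype S₀]

theorem sum_Amgf_zero (i : S₀) : ∑ j, W.Amgf (0, 0) i j = 1 := by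
  let e : Fin 3 × Fin 3 × S₀ → MMRWState S₀ := fun p =>
    (1 - ((p.1 : ℕ) : ℤ), 1 - ((p.2.1 : ℕ) : ℤ), p.2.2)
  have he : Function.Injective e := by
    rintro ⟨s, t, i⟩ ⟨s', t', i'⟩ h
    simp only [e, Prod.mk.injEq] at h
    obtain ⟨h1, h2, h3⟩ := h
    simp only [Prod.mk.injEq, Fin.ext_iff]
    exact ⟨by lia, by lia, h3⟩
  have h1 : ∑' y, W.step (0, 0, i) y = 1 := PMF.tsum_coe _
  rw [← he.tsum_eq, tsum_fintype] at h1
  · have h2 := congrArg ENNReal.toReal h1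
    rw [ENNReal.toReal_sum fun p _ => PMF.apply_ne_top _ _] at h2
    simp only [Fintype.sum_prod_type, ENNReal.toReal_one] at h2
    rw [← h2]
    simp only [Amgf_apply, mul_zero, add_zero, Real.exp_zero, one_mul]
    rw [Finset.sum_comm]
    exact Finset.sum_congr rfl fun s _ => Finset.sum_comm
  · rintro ⟨x₁, x₂, j⟩ hx
    obtain ⟨h1, h2⟩ := W.skipFree _ _ _ _ _ _ hx
    obtain ⟨s, hs⟩ := mem_offsets h1
    obtain ⟨t, ht⟩ := mem_offsets h2
    refine ⟨(s, t, j), ?_⟩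
    simp only [e, Prod.mk.injEq, and_true]
    exact ⟨by lia, by lia⟩

/-- Maximum principle: the phases where `g` is maximal are closed under transitions, so the measure
equal to `∞` on them and `0` elsewhere is excessive for `P`, against irreducibility unless they are
all the phases. -/
theorem const_of_harmonic [Nonempty S₀] (hP : W.P.Irreducible) {g : S₀ → ℝ}
    (hg : (W.Amgf (0, 0)).mulVec g = g) : ∃ c, g = fun _ => c := by
  classical
  obtain ⟨i₀, hi₀⟩ := Finite.exists_max g
  have hclosed : ∀ i j, g i = g i₀ → W.Amgf (0, 0) i j ≠ 0 → g j = g i₀ := fun i j hi hB => by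
    have h1 : ∑ j, W.Amgf (0, 0) i j * (g i₀ - g j) = 0 := by
      have h2 : ∑ j, W.Amgf (0, 0) i j * g j = g i := congrFun hg i
      simp only [mul_sub, Finset.sum_sub_distrib, ← Finset.sum_mul, W.sum_Amgf_zero, h2, hi]
      ring
    rw [Finset.sum_eq_zero_iff_of_nonneg fun j _ =>
      mul_nonneg (W.Amgf_nonneg _ _ _) (sub_nonneg.2 (hi₀ j))] at h1
    have h3 := (mul_eq_zero.1 (h1 j (Finset.mem_univ j))).resolve_left hB
    linarith
  refine ⟨g i₀, funext fun j => ?_⟩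
  by_contra hj
  let q : MMRWState S₀ → ℝ≥0∞ := fun y => if g y.2.2 = g i₀ then ∞ else 0
  refine hP.excessive_ne_zero (q := q) (i := (0, 0, i₀)) ?_ (by simp [q]) (0, 0, j)
    (by simp [q, hj])
  rintro ⟨y₁, y₂, j⟩
  by_cases hj : g j = g i₀
  · simp [q, hj]
  refine le_of_eq_of_le (ENNReal.tsum_eq_zero.2 ?_) bot_le
  rintro ⟨x₁, x₂, i⟩
  by_cases hi : g i = g i₀
  · have : W.Amgf (0, 0) i j = 0 := by
      by_contra hB
      exact hj (hclosed i j hi hB)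
    rw [P_eq_A, W.A_eq_zero_of_Amgf_eq_zero this, mul_zero]
  · simp [q, hi]

variable [DecidableEq S₀]

/-- The sum `β` is the stationary mean of the derivative of `A(t d)` at `t = 0`. Correcting the
vector `1` to `1 + t g` by a Poisson solution spreads it evenly over the phases: `A(t d)(1 + t g) =
1 + t g + t β + o(t)`, strictly below `1 + t g` for small `t > 0`. -/
theorem Gam_nonempty_of_direction (hP : W.P.Irreducible) {π : S₀ → ℝ} (hπ : W.IsStationary π)
    (d : ℝ × ℝ) (hβ : ∑ i, π i * ∑ j, ∑ s : Fin 3, ∑ t : Fin 3,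
      ((1 - (s : ℕ)) * d.1 + (1 - (t : ℕ)) * d.2) *
        W.Areal (1 - (s : ℕ)) (1 - (t : ℕ)) i j < 0) : W.Gam.Nonempty := by
  obtain ⟨hπ0, hπ1, hπB⟩ := hπ
  have hne : π ≠ 0 := by rintro rfl; simp at hπ1
  have : Nonempty S₀ := by
    obtain ⟨i, -⟩ := Function.ne_iff.1 hne
    exact ⟨i⟩
  set D : S₀ → S₀ → ℝ := fun i j => ∑ s : Fin 3, ∑ t : Fin 3,
      ((1 - (s : ℕ)) * d.1 + (1 - (t : ℕ)) * d.2) * W.Areal (1 - (s : ℕ)) (1 - (t : ℕ)) i j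
  set β := ∑ i, π i * ∑ j, D i j
  obtain ⟨g, hg⟩ := exists_poisson hne hπB (fun g => W.const_of_harmonic hP)
    (f := fun i => ∑ j, D i j - β) (by
      simp only [dotProduct, mul_sub, Finset.sum_sub_distrib, ← Finset.sum_mul, hπ1, one_mul]
      exact sub_self _)
  have hg' : ∀ i, ∑ j, W.Amgf (0, 0) i j * g j = g i - (∑ j, D i j - β) := fun i => by
    have := congrFun hg i
    simp only [Pi.sub_apply, Matrix.mulVec, dotProduct] at this
    linarith
  have hderivA : ∀ i j, HasDerivAt (fun t : ℝ => W.Amgf (t • d) i j) (D i j) 0 := fun i j => by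
    simp only [Amgf_apply, D]
    refine HasDerivAt.fun_sum fun s _ => HasDerivAt.fun_sum fun r _ => HasDerivAt.mul_const ?_ _
    have h1 : HasDerivAt (fun t : ℝ => (1 - (s : ℕ)) * (t • d).1 + (1 - (r : ℕ)) * (t • d).2)
        ((1 - (s : ℕ)) * d.1 + (1 - (r : ℕ)) * d.2) 0 := by
      have e : (fun t : ℝ => (1 - (s : ℕ)) * (t • d).1 + (1 - (r : ℕ)) * (t • d).2) =
          fun t => t * ((1 - (s : ℕ)) * d.1 + (1 - (r : ℕ)) * d.2) := by
        funext t
        simp only [Prod.smul_fst, Prod.smul_snd, smul_eq_mul]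
        ring
      rw [e]
      simpa using (hasDerivAt_id (0 : ℝ)).mul_const ((1 - (s : ℕ)) * d.1 + (1 - (r : ℕ)) * d.2)
    have h2 := h1.exp
    simpa using h2
  have hderiv : ∀ i, HasDerivAt
      (fun t : ℝ => ∑ j, W.Amgf (t • d) i j * (1 + t * g j) - (1 + t * g i)) β 0 := fun i => by
    have h1 : ∀ j, HasDerivAt (fun t : ℝ => 1 + t * g j) (g j) 0 := fun j => by
      simpa using ((hasDerivAt_id (0 : ℝ)).mul_const (g j)).const_add 1
    have h2 := (HasDerivAt.fun_sum (u := Finset.univ) fun j _ =>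
      (hderivA i j).mul (h1 j)).sub (h1 i)
    refine h2.congr_deriv ?_
    simp only [zero_mul, add_zero, mul_one, zero_smul, Finset.sum_add_distrib]
    have := hg' i
    rw [show ((0 : ℝ), (0 : ℝ)) = (0 : ℝ × ℝ) from rfl] at this
    rw [this]
    ring
  have hev : ∀ i, ∀ᶠ t in 𝓝[>] (0 : ℝ),
      ∑ j, W.Amgf (t • d) i j * (1 + t * g j) < 1 + t * g i := fun i => by
    have h1 := (hasDerivAt_iff_tendsto_slope.1 (hderiv i)).mono_left
      (nhdsWithin_mono (0 : ℝ) fun t (ht : 0 < t) => ht.ne')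
    filter_upwards [h1.eventually_lt_const hβ, self_mem_nhdsWithin] with t ht ht0
    have h0 : ∑ j, W.Amgf 0 i j = 1 := W.sum_Amgf_zero i
    simp only [slope_def_field, zero_mul, add_zero, mul_one, zero_smul, h0, sub_self,
      sub_zero] at ht
    rw [div_lt_iff₀ ht0, zero_mul] at ht
    linarith
  have hev' : ∀ i, ∀ᶠ t in 𝓝[>] (0 : ℝ), 0 < 1 + t * g i := fun i => by
    have hc : Continuous fun t : ℝ => 1 + t * g i := by fun_prop
    exact nhdsWithin_le_nhds (hc.continuousAt.eventually_const_lt (by simp))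
  obtain ⟨t, ht, ht'⟩ := ((eventually_all.2 hev).and (eventually_all.2 hev')).exists
  set h : S₀ → ℝ := fun i => 1 + t * g i
  -- The largest of the finitely many ratios serves as `ρ`, and each ratio is below one.
  obtain ⟨i₁, hi₁⟩ := Finite.exists_max fun i => (∑ j, W.Amgf (t • d) i j * h j) / h i
  refine ⟨t • d, (spectralRadius_le_of_right (W.Amgf_nonneg _) (v := h)
    (ρ := (∑ j, W.Amgf (t • d) i₁ j * h j) / h i₁) ht' fun i =>
      (div_le_iff₀ (ht' i)).1 (hi₁ i)).trans_lt ?_⟩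
  rw [ENNReal.ofReal_lt_one, div_lt_one (ht' i₁)]
  exact ht i₁

theorem Gam_nonempty (hP : W.P.Irreducible) {π : S₀ → ℝ} (hπ : W.IsStationary π)
    (hdrift : W.drift₁ π < 0 ∨ W.drift₂ π < 0) : W.Gam.Nonempty := by
  rcases hdrift with h | h
  · refine W.Gam_nonempty_of_direction hP hπ (1, 0) (lt_of_eq_of_lt ?_ h)
    simp only [drift₁, dotProduct, Matrix.mulVec]
    refine Finset.sum_congr rfl fun i _ => ?_
    congr 1
    refine Finset.sum_congr rfl fun j _ => ?_
    simp [Fin.sum_univ_three, Matrix.add_apply]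
    norm_num
    ring
  · refine W.Gam_nonempty_of_direction hP hπ (0, 1) (lt_of_eq_of_lt ?_ h)
    simp only [drift₂, dotProduct, Matrix.mulVec]
    refine Finset.sum_congr rfl fun i _ => ?_
    congr 1
    refine Finset.sum_congr rfl fun j _ => ?_
    simp [Fin.sum_univ_three, Matrix.add_apply]
    norm_num
    ring

end MMRW

/-! ### Identification of the radii -/

namespace MMRW

open NNMat MeasureTheory

theorem le_ofReal_exp_of_log_le {r : ℝ≥0} {t : ℝ} (h : r ≠ 0 → Real.log r ≤ t) :
    (r : ℝ≥0∞) ≤ ENNReal.ofReal (Real.exp t) := by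
  rcases eq_or_ne r 0 with rfl | hr
  · simp
  rw [ENNReal.coe_nnreal_eq]
  exact ENNReal.ofReal_le_ofReal
    ((Real.log_le_iff_le_exp (by exact_mod_cast pos_iff_ne_zero.2 hr)).1 (h hr))

/-- A supremum over radii is at least `b` if every smaller radius is admissible. -/
theorem le_iSup_radius {p : ℝ≥0 → Prop} {b : ℝ≥0∞} (h : ∀ r : ℝ≥0, (r : ℝ≥0∞) < b → p r) :
    b ≤ ⨆ (r : ℝ≥0) (_ : p r), (r : ℝ≥0∞) := by
  refine le_of_forall_lt fun s hs => ?_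
  obtain ⟨r, hsr, hr⟩ := ENNReal.lt_iff_exists_nnreal_btwn.1 hs
  exact hsr.trans_le (le_iSup₂_of_le r (h r hr) le_rfl)

theorem exp_le_of_forall_mem {Γ : Set (ℝ × ℝ)} {f : ℝ × ℝ → ℝ} (hf : Continuous f) {b : ℝ≥0∞}
    (h : ∀ θ ∈ Γ, ENNReal.ofReal (Real.exp (f θ)) ≤ b) {t : ℝ} (ht : t ∈ f '' closure Γ) :
    ENNReal.ofReal (Real.exp t) ≤ b := by
  obtain ⟨θ, hθ, rfl⟩ := ht
  have hc : Continuous fun θ => ENNReal.ofReal (Real.exp (f θ)) :=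
    ENNReal.continuous_ofReal.comp (Real.continuous_exp.comp hf)
  exact closure_minimal h (isClosed_le hc continuous_const) hθ

theorem tsum_zero_term_lt_top {f : ℕ → ℝ≥0∞} (hf : f 0 ≠ ∞) {r : ℝ≥0}
    (h : ∑' k, (r : ℝ≥0∞) ^ (k + 1) * f (k + 1) < ∞) : ∑' k, f k * (r : ℝ≥0∞) ^ k < ∞ := by
  rw [tsum_eq_zero_add' ENNReal.summable]
  simp only [pow_zero, mul_one, mul_comm (f (_ + 1))]
  exact ENNReal.add_lt_top.2 ⟨hf.lt_top, h⟩

theorem tsum_succ_lt_top {f : ℕ → ℝ≥0∞} {r : ℝ≥0}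
    (h : ∑' k, f k * (r : ℝ≥0∞) ^ k < ∞) : ∑' k, (r : ℝ≥0∞) ^ (k + 1) * f (k + 1) < ∞ := by
  rw [tsum_eq_zero_add' ENNReal.summable] at h
  simp only [mul_comm (f (_ + 1))] at h
  exact (ENNReal.add_lt_top.1 h).2

variable {S₀ : Type*} [Fintype S₀] [DecidableEq S₀] {W : MMRW S₀} {Ω : Type*} [MeasurableSpace Ω]
  {ℙ : MMRWState S₀ → Measure Ω} {Y : ℕ → Ω → MMRWState S₀} {t : ℝ}

theorem rad₁_eq (hY : ∀ y, W.IsChain (ℙ y) Y y) (hW : W.Pplus.Irreducible)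
    (hne : W.Gam.Nonempty) (ht : IsGreatest (Prod.fst '' closure W.Gam) t) (y : MMRWQuad S₀)
    (l : ℕ) (j : S₀) : rad₁ ℙ Y y l j = ENNReal.ofReal (Real.exp t) := by
  simp only [rad₁, gen₁, occ_eq_green hY]
  refine le_antisymm (iSup₂_le fun r hr => le_ofReal_exp_of_log_le fun hr0 => ?_)
    (exp_le_of_forall_mem continuous_fst (fun θ hθ => le_iSup_radius fun r hr =>
      W.tsum_green_lt_top₁ hθ y l j hr) ht.1)
  obtain ⟨θ, hθ, h⟩ := exists_mem_closure_Gam_of_excessive₁ hW hne (W.vmul_green_le y)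
    (W.green_self_ne_zero y) (W.green_ne_top hne y) l j hr0 hr
  exact h.trans (ht.2 ⟨θ, hθ, rfl⟩)

theorem rad₂_eq (hY : ∀ y, W.IsChain (ℙ y) Y y) (hW : W.Pplus.Irreducible)
    (hne : W.Gam.Nonempty) (ht : IsGreatest (Prod.snd '' closure W.Gam) t) (y : MMRWQuad S₀)
    (l : ℕ) (j : S₀) : rad₂ ℙ Y y l j = ENNReal.ofReal (Real.exp t) := by
  simp only [rad₂, gen₂, occ_eq_green hY]
  refine le_antisymm (iSup₂_le fun r hr => le_ofReal_exp_of_log_le fun hr0 => ?_)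
    (exp_le_of_forall_mem continuous_snd (fun θ hθ => le_iSup_radius fun r hr =>
      W.tsum_green_lt_top₂ hθ y l j hr) ht.1)
  obtain ⟨θ, hθ, h⟩ := exists_mem_closure_Gam_of_excessive₂ hW hne (W.vmul_green_le y)
    (W.green_self_ne_zero y) (W.green_ne_top hne y) l j hr0 hr
  exact h.trans (ht.2 ⟨θ, hθ, rfl⟩)

variable [Nonempty S₀]

theorem cp_rate₁_eq (hW : W.Pplus.Irreducible) (hne : W.Gam.Nonempty)
    (ht : IsGreatest (Prod.fst '' closure W.Gam) t) :
    cp (rate (W.A1 (-1)) (W.A1 0) (W.A1 1)) = ENNReal.ofReal (Real.exp t) := by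
  refine le_antisymm (iSup₂_le fun r hr => le_ofReal_exp_of_log_le fun hr0 => ?_)
    (exp_le_of_forall_mem continuous_fst (fun θ hθ => exp_le_cp_rate₁ hθ) ht.1)
  obtain ⟨θ, hθ, h⟩ := exists_mem_closure_Gam_of_rate₁ hW hne (isRateMatrix_A1 hne) hr0 hr
  exact h.trans (ht.2 ⟨θ, hθ, rfl⟩)

theorem cp_rate₂_eq (hW : W.Pplus.Irreducible) (hne : W.Gam.Nonempty)
    (ht : IsGreatest (Prod.snd '' closure W.Gam) t) :
    cp (rate (W.A2 (-1)) (W.A2 0) (W.A2 1)) = ENNReal.ofReal (Real.exp t) := by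
  refine le_antisymm (iSup₂_le fun r hr => le_ofReal_exp_of_log_le fun hr0 => ?_)
    (exp_le_of_forall_mem continuous_snd (fun θ hθ => exp_le_cp_rate₂ hθ) ht.1)
  obtain ⟨θ, hθ, h⟩ := exists_mem_closure_Gam_of_rate₂ hW hne (isRateMatrix_A2 hne) hr0 hr
  exact h.trans (ht.2 ⟨θ, hθ, rfl⟩)

/-- One diagonal entry at level `0` already bounds the radius from above, the missing term `k = 0`
being a finite Green function value; from below, all entries converge together. -/
theorem radPhi₁_eq (hY : ∀ y, W.IsChain (ℙ y) Y y) (hW : W.Pplus.Irreducible)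
    (hne : W.Gam.Nonempty) (ht : IsGreatest (Prod.fst '' closure W.Gam) t) (x : ℕ × ℕ) :
    radPhi₁ ℙ Y x = ENNReal.ofReal (Real.exp t) := by
  obtain ⟨j⟩ := ‹Nonempty S₀›
  rw [← rad₁_eq hY hW hne ht (x.1, x.2, j) 0 j]
  refine le_antisymm (iSup₂_mono' fun r hr => ⟨r, ?_, le_rfl⟩) ?_
  · refine tsum_zero_term_lt_top ?_ (hr j j)
    rw [occ_eq_green hY]
    exact W.green_ne_top hne _ _
  · rw [rad₁_eq hY hW hne ht]
    refine exp_le_of_forall_mem continuous_fst (fun θ hθ => le_iSup_radius fun r hr i j => ?_) ht.1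
    simp only [Phi₁, N, occ_eq_green hY]
    exact tsum_succ_lt_top (f := fun k => W.green _ (k, 0, j)) (W.tsum_green_lt_top₁ hθ _ 0 j hr)

theorem radPhi₂_eq (hY : ∀ y, W.IsChain (ℙ y) Y y) (hW : W.Pplus.Irreducible)
    (hne : W.Gam.Nonempty) (ht : IsGreatest (Prod.snd '' closure W.Gam) t) (x : ℕ × ℕ) :
    radPhi₂ ℙ Y x = ENNReal.ofReal (Real.exp t) := by
  obtain ⟨j⟩ := ‹Nonempty S₀›
  rw [← rad₂_eq hY hW hne ht (x.1, x.2, j) 0 j]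
  refine le_antisymm (iSup₂_mono' fun r hr => ⟨r, ?_, le_rfl⟩) ?_
  · refine tsum_zero_term_lt_top ?_ (hr j j)
    rw [occ_eq_green hY]
    exact W.green_ne_top hne _ _
  · rw [rad₂_eq hY hW hne ht]
    refine exp_le_of_forall_mem continuous_snd (fun θ hθ => le_iSup_radius fun r hr i j => ?_) ht.1
    simp only [Phi₂, N, occ_eq_green hY]
    exact tsum_succ_lt_top (f := fun k => W.green _ (0, k, j)) (W.tsum_green_lt_top₂ hθ _ 0 j hr)

end MMRW

theorem mainTheorem5 {S₀ : Type*} [Fintype S₀] [DecidableEq S₀] (W : MMRW S₀)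
    (hP : W.P.Irreducible) (hPap : W.P.Aperiodic)
    (π : S₀ → ℝ) (hπ : W.IsStationary π) (hdrift : W.drift₁ π < 0 ∨ W.drift₂ π < 0)
    (hPplus : W.Pplus.Irreducible)
    {Ω : Type*} [MeasurableSpace Ω] (ℙ : MMRWState S₀ → MeasureTheory.Measure Ω)
    (Y : ℕ → Ω → MMRWState S₀) (hY : ∀ y, W.IsChain (ℙ y) Y y) :
    ∃ (θ₁ θ₂ : ℝ) (R₁ R₂ : NNMat (ℕ × S₀)),
      IsGreatest (Prod.fst '' closure W.Gam) θ₁ ∧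
      IsGreatest (Prod.snd '' closure W.Gam) θ₂ ∧
      NNMat.IsRateMatrix (W.A1 (-1)) (W.A1 0) (W.A1 1) R₁ ∧
      NNMat.IsRateMatrix (W.A2 (-1)) (W.A2 0) (W.A2 1) R₂ ∧
      (∀ (y : MMRWQuad S₀) (x₂' : ℕ) (j' : S₀),
        MMRW.rad₁ ℙ Y y x₂' j' = R₁.cp ∧ R₁.cp = ENNReal.ofReal (Real.exp θ₁)) ∧
      (∀ (y : MMRWQuad S₀) (x₁' : ℕ) (j' : S₀),
        MMRW.rad₂ ℙ Y y x₁' j' = R₂.cp ∧ R₂.cp = ENNReal.ofReal (Real.exp θ₂)) ∧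
      (∀ x : ℕ × ℕ, MMRW.radPhi₁ ℙ Y x = ENNReal.ofReal (Real.exp θ₁)) ∧
      (∀ x : ℕ × ℕ, MMRW.radPhi₂ ℙ Y x = ENNReal.ofReal (Real.exp θ₂)) := by
  have hne : W.Gam.Nonempty := W.Gam_nonempty hP hπ hdrift
  have : Nonempty S₀ := by
    by_contra h
    have : IsEmpty S₀ := not_nonempty_iff.1 h
    simpa using hπ.2.1
  have hcpt := W.isCompact_closure_Gam hP
  obtain ⟨θ₁, hθ₁⟩ := (hcpt.image continuous_fst).exists_isGreatest (hne.closure.image _)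
  obtain ⟨θ₂, hθ₂⟩ := (hcpt.image continuous_snd).exists_isGreatest (hne.closure.image _)
  have hcp₁ := MMRW.cp_rate₁_eq hPplus hne hθ₁
  have hcp₂ := MMRW.cp_rate₂_eq hPplus hne hθ₂
  exact ⟨θ₁, θ₂, _, _, hθ₁, hθ₂, MMRW.isRateMatrix_A1 hne, MMRW.isRateMatrix_A2 hne,
    fun y l j => ⟨(MMRW.rad₁_eq hY hPplus hne hθ₁ y l j).trans hcp₁.symm, hcp₁⟩,
    fun y l j => ⟨(MMRW.rad₂_eq hY hPplus hne hθ₂ y l j).trans hcp₂.symm, hcp₂⟩,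
    MMRW.radPhi₁_eq hY hPplus hne hθ₁, MMRW.radPhi₂_eq hY hPplus hne hθ₂⟩
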